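/- Fix $0<\alpha<1$. For $n\in\mathbb R^2$ write $\langle n\rangle=(1+|n|^2)^{1/2}$, and for integrable $f:\mathbb R^2\to\mathbb R$ write $\widehat f(n)=\int_{\mathbb R^2} f(x)e^{-2\pi i x\cdot n}\,dx$. Let $Q:\mathbb R^2\to\mathbb R^{2\times 2}$ be the continuous function with Fourier transform $\widehat Q(n)=\langle n\rangle^{-(2+2\alpha)}\bigl(I-\frac{nn^{\top}}{|n|^2}\bigr)$, that is $$Q(x)=\int_{\mathbb R^2}\langle n\rangle^{-(2+2\alpha)}\Bigl(I-\frac{nn^{\top}}{|n|^2}\Bigr)e^{2\pi i x\cdot n}\,dn ,$$ let $G(x)=-\frac1{2\pi}\log|x|$, and let $D^2G(x)$ be its pointwise Hessian at $x\neq0$. Let $\varphi:\mathbb R^2\to\mathbb R$ be a radial $C^\infty$ function with $0\le\varphi\le1$, $\varphi(x)=1$ for $|x|\le1$ and $\varphi(x)=0$ for $|x|\ge2$. Put $$A(x)=\mathrm{tr}\bigl[(Q(0)-Q(x))D^2G(x)\bigr]\varphi(x),\qquad x\ne0,$$ $$\beta_L=4\int_0^\infty\rho^{-1-2\alpha}(1-\cos(2\pi\rho))\,d\rho\int_0^1(1-u^2)\,u^{2\alpha}(1-u^2)^{-1/2}\,du,\qquad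 \gamma_{2\alpha}=\frac{\pi\,2^{2\alpha}\,\Gamma(\alpha)}{\Gamma(1-\alpha)} .$$ Then $\frac{\alpha\beta_L\gamma_{2\alpha}}{4\pi(2\pi)^{2\alpha}}>0$, the function $A$ is integrable, its Fourier transform $\widehat A$ is real-valued, and there is a constant $C>0$ (depending only on $\alpha$ and $\varphi$) such that $$\widehat A(n)\le-\frac{\alpha\beta_L\gamma_{2\alpha}}{4\pi(2\pi)^{2\alpha}}\,\langle n\rangle^{-2\alpha}+C\langle n\rangle^{-2}\qquad\text{for all } n\in\mathbb R^2 .$$ -/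

import Mathlib

open MeasureTheory
open scoped FourierTransform ContDiff SchwartzMap

noncomputable section

namespace Kraichnan

/-- The Euclidean plane. -/
abbrev Plane : Type := EuclideanSpace ℝ (Fin 2)

/-- The Japanese bracket `⟨n⟩ = (1 + |n|²)^{1/2}`. -/
def bracket (n : Plane) : ℝ := Real.sqrt (1 + ‖n‖ ^ 2)

/-- The matrix-valued function `Q̂(n) = ⟨n⟩^{-(2+2α)} (I - n nᵀ / |n|²)`. -/
def Qhat (α : ℝ) (n : Plane) : Matrix (Fin 2) (Fin 2) ℝ :=
  bracket n ^ (-(2 + 2 * α)) •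
    ((1 : Matrix (Fin 2) (Fin 2) ℝ) - (‖n‖ ^ 2)⁻¹ • Matrix.vecMulVec n.ofLp n.ofLp)

/-- The Kraichnan covariance `Q(x) = ∫ Q̂(n) e^{2πi x·n} dn`, the continuous function whose Fourier
transform is the integrable function `Q̂`. The integral is real, so that taking the real part only
changes its type, see `Q_ofReal`; see also `Q_fourier`. -/
def Q (α : ℝ) (x : Plane) : Matrix (Fin 2) (Fin 2) ℝ :=
  Matrix.of fun i j => (𝓕⁻ (fun n : Plane => (Qhat α n i j : ℂ)) x).re

/-- The Green kernel of `-Δ` on the plane. -/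
def G (x : Plane) : ℝ := -(1 / (2 * Real.pi)) * Real.log ‖x‖

/-- The matrix of second partial derivatives of `f` at `x`. -/
def hessian (f : Plane → ℝ) (x : Plane) : Matrix (Fin 2) (Fin 2) ℝ :=
  Matrix.of fun i j =>
    iteratedFDeriv ℝ 2 f x ![EuclideanSpace.single i (1 : ℝ), EuclideanSpace.single j (1 : ℝ)]

/-- A smooth radial cutoff with values in `[0, 1]`, equal to `1` on the closed unit ball and to `0`
outside the open ball of radius `2`. -/
structure IsRadialCutoff (φ : Plane → ℝ) : Prop where
  smooth : ContDiff ℝ ∞ φ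
  radial : ∀ x y : Plane, ‖x‖ = ‖y‖ → φ x = φ y
  nonneg : ∀ x, 0 ≤ φ x
  le_one : ∀ x, φ x ≤ 1
  eq_one : ∀ x, ‖x‖ ≤ 1 → φ x = 1
  eq_zero : ∀ x, 2 ≤ ‖x‖ → φ x = 0

/-- `A(x) = tr[(Q(0) - Q(x)) D²G(x)] φ(x)`, with the pointwise Hessian of `G` at `x ≠ 0`. -/
def A (α : ℝ) (φ : Plane → ℝ) (x : Plane) : ℝ :=
  ((Q α 0 - Q α x) * hessian G x).trace * φ x

/-- `β_f = 4 (∫_0^∞ ρ^{-1-2α} (1 - cos(2πρ)) dρ) (∫_0^1 f(u) u^{2α} (1-u²)^{-1/2} du)`. -/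
def betaCoeff (α : ℝ) (f : ℝ → ℝ) : ℝ :=
  4 * (∫ ρ in Set.Ioi (0 : ℝ), ρ ^ (-1 - 2 * α) * (1 - Real.cos (2 * Real.pi * ρ))) *
    ∫ u in Set.Ioo (0 : ℝ) 1, f u * u ^ (2 * α) * (1 - u ^ 2) ^ (-(1 / 2) : ℝ)

/-- `β_L = β_f` for `f(u) = 1 - u²`. -/
def betaL (α : ℝ) : ℝ := betaCoeff α fun u => 1 - u ^ 2

/-- The Riesz constant `γ_{2β} = π 2^{2β} Γ(β) / Γ(1-β)`, as a function of `s = 2β`. -/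
def rieszGamma (s : ℝ) : ℝ :=
  Real.pi * 2 ^ s * Real.Gamma (s / 2) / Real.Gamma (1 - s / 2)

/-- The constant `α β_L γ_{2α} / (4π (2π)^{2α})`. -/
def coercivityConst (α : ℝ) : ℝ :=
  α * betaL α * rieszGamma (2 * α) / (4 * Real.pi * (2 * Real.pi) ^ (2 * α))

theorem Qhat_neg (α : ℝ) (n : Plane) : Qhat α (-n) = Qhat α n := by
  simp [Qhat, bracket, Matrix.neg_vecMulVec, Matrix.vecMulVec_neg]

theorem Q_ofReal (α : ℝ) (x : Plane) (i j : Fin 2) :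
    (Q α x i j : ℂ) = 𝓕⁻ (fun n : Plane => (Qhat α n i j : ℂ)) x := by
  change (((𝓕⁻ (fun n : Plane => (Qhat α n i j : ℂ)) x).re : ℝ) : ℂ) = _
  rw [← Complex.conj_eq_iff_re, Real.fourierInv_eq', ← integral_conj, ← integral_neg_eq_self]
  congr 1
  funext n
  simp [Qhat_neg, ← Complex.exp_conj, Complex.conj_ofNat]

theorem Qhat_integrable {α : ℝ} (hα : 0 < α) (i j : Fin 2) :
    Integrable (fun n : Plane => (Qhat α n i j : ℂ)) := by
  have h0 : Integrable (fun n : Plane => ((1 : ℝ) + ‖n‖ ^ 2) ^ (-(2 + 2 * α) / 2)) :=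
    integrable_rpow_neg_one_add_norm_sq (by simp [hα])
  refine ((h0.const_mul 2).mono' (f := fun n : Plane => Qhat α n i j) ?_
    (Filter.Eventually.of_forall fun n => ?_)).ofReal
  · apply Measurable.aestronglyMeasurable
    simp only [Qhat, bracket, Matrix.smul_apply, Matrix.sub_apply, Matrix.vecMulVec_apply,
      smul_eq_mul]
    fun_prop
  · have hb : bracket n ^ (-(2 + 2 * α)) = ((1 : ℝ) + ‖n‖ ^ 2) ^ (-(2 + 2 * α) / 2) := by
      rw [bracket, Real.sqrt_eq_rpow, ← Real.rpow_mul (by positivity)]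
      ring_nf
    have hi : ∀ k : Fin 2, |n k| ≤ ‖n‖ := fun k => by simpa using PiLp.norm_apply_le n k
    have h1 : |(1 : Matrix (Fin 2) (Fin 2) ℝ) i j| ≤ 1 := by
      by_cases h : i = j <;> simp [Matrix.one_apply, h]
    have h2 : |(‖n‖ ^ 2)⁻¹ * (n i * n j)| ≤ 1 := by
      rw [abs_mul, abs_mul, abs_of_nonneg (by positivity : (0 : ℝ) ≤ (‖n‖ ^ 2)⁻¹)]
      calc (‖n‖ ^ 2)⁻¹ * (|n i| * |n j|) ≤ (‖n‖ ^ 2)⁻¹ * (‖n‖ * ‖n‖) := by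
            gcongr <;> exact hi _
        _ ≤ 1 := by rw [← sq]; exact inv_mul_le_one
    simp only [Qhat, Matrix.smul_apply, Matrix.sub_apply, Matrix.vecMulVec_apply, smul_eq_mul,
      Real.norm_eq_abs]
    rw [hb, abs_mul, abs_of_nonneg (by positivity), mul_comm]
    gcongr
    exact (abs_sub _ _).trans (by linarith)

/-- The tempered distribution `Q` has Fourier transform `Q̂`. -/
theorem Q_fourier {α : ℝ} (hα : 0 < α) (i j : Fin 2) (ψ : 𝓢(Plane, ℂ)) :
    ∫ x, (Q α x i j : ℂ) * 𝓕 (ψ : Plane → ℂ) x = ∫ n, (Qhat α n i j : ℂ) * ψ n := by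
  have h := VectorFourier.integral_fourierIntegral_smul_eq_flip (μ := volume) (ν := volume)
    (L := -innerₗ Plane) Real.continuous_fourierChar
    (continuous_inner.neg) (Qhat_integrable hα i j) (𝓕 ψ : 𝓢(Plane, ℂ)).integrable
  have hf : (-innerₗ Plane : Plane →ₗ[ℝ] Plane →ₗ[ℝ] ℝ).flip = -innerₗ Plane := by
    ext x y; simp [real_inner_comm]
  rw [hf] at h
  simp only [Q_ofReal]
  refine h.trans ?_
  congr 1
  funext n
  have h1 : 𝓕⁻ (𝓕 ψ : 𝓢(Plane, ℂ)) = ψ := FourierTransform.fourierInv_fourier_eq ψ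
  conv_rhs => rw [← h1, SchwartzMap.fourierInv_coe]
  rfl

end Kraichnan

end

/-! The longitudinal part of `Qhat` is a superposition of Gaussians. With w = `weight α`, the
regularized incomplete Gamma function, the Laplace identity r⁻¹(1+r)^{-(1+α)} = ∫₀^∞ w(s)e^{-rs} ds
at r = |m|² rewrites mᵢmⱼ|m|⁻²⟨m⟩^{-(2+2α)} as an integral of mᵢmⱼe^{-s|m|²}. Second moments of
Gaussians are explicit, so Q(x) = q(x)I + π³xxᵀg(x), where g = `gaussianMixture α` is a positive
mixture of the functions e^{-π²|x|²/s} (`Q_apply_eq`).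

Away from 0 the Hessian of G is traceless, so the scalar parts of Q(0) and Q(x) drop out. Since
xᵀD²G(x)x = 1/(2π), this leaves A = -(π²/2)gφ almost everywhere (`trace_Q_mul_hessian`).

The mixture is integrable and its transform is π⁻¹∫₀^∞ w(s)s⁻²e^{-s|n|²} ds
(`fourier_gaussianMixture`). The bounds e^{-s}s^{1+α}/Γ(2+α) ≤ w(s) ≤ s^{1+α}/Γ(2+α) squeeze the
last integral between (1+|n|²)^{-α} and |n|^{-2α}, both divided by α(α+1). Multiplying by φ
convolves this transform with a Schwartz function of total mass φ(0) = 1, which preserves the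
leading asymptotics by dominated convergence. Hence ⟨n⟩^{2α}Â(n) → -π/(2α(α+1))
(`tendsto_fourier_A`).

Evaluating the Gamma and Beta integrals shows that the constant of the theorem is c = π/(8α(α+1)), a
quarter of the absolute value of this limit (`coercivityConst_eq`). The bound -c⟨n⟩^{-2α} therefore
holds for large |n| with room to spare, and on the remaining bounded set the term C⟨n⟩⁻² absorbs
everything. -/

noncomputable section

namespace Kraichnan

/-! ### The incomplete Gamma weight and its Laplace transform -/

/-- The regularized lower incomplete Gamma function `Γ(1+α)⁻¹ ∫_0^s t^α e^{-t} dt`. -/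
def weight (α s : ℝ) : ℝ := (Real.Gamma (1 + α))⁻¹ * ∫ t in (0 : ℝ)..s, t ^ α * Real.exp (-t)

theorem continuous_rpow_mul_exp_neg {α : ℝ} (hα : 0 < α) :
    Continuous fun t : ℝ => t ^ α * Real.exp (-t) :=
  (Real.continuous_rpow_const hα.le).mul (by fun_prop)

theorem hasDerivAt_weight {α : ℝ} (hα : 0 < α) (s : ℝ) :
    HasDerivAt (weight α) ((Real.Gamma (1 + α))⁻¹ * (s ^ α * Real.exp (-s))) s :=
  (intervalIntegral.integral_hasDerivAt_right
    ((continuous_rpow_mul_exp_neg hα).intervalIntegrable _ _)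
    ((continuous_rpow_mul_exp_neg hα).stronglyMeasurableAtFilter _ _)
    (continuous_rpow_mul_exp_neg hα).continuousAt).const_mul _

theorem continuous_weight {α : ℝ} (hα : 0 < α) : Continuous (weight α) :=
  continuous_iff_continuousAt.2 fun s => (hasDerivAt_weight hα s).continuousAt

theorem weight_zero (α : ℝ) : weight α 0 = 0 := by simp [weight]

theorem weight_nonneg {α s : ℝ} (hα : 0 < α) (hs : 0 ≤ s) : 0 ≤ weight α s := by
  refine mul_nonneg (inv_nonneg.2 (Real.Gamma_pos_of_pos (by linarith)).le) ?_
  refine intervalIntegral.integral_nonneg hs fun t ht => ?_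
  have := Real.rpow_nonneg ht.1 α
  positivity

theorem weight_le_one {α s : ℝ} (hα : 0 < α) (hs : 0 ≤ s) : weight α s ≤ 1 := by
  have hG : 0 < Real.Gamma (1 + α) := Real.Gamma_pos_of_pos (by linarith)
  rw [weight, inv_mul_le_iff₀ hG, mul_one, Real.Gamma_eq_integral (by linarith),
    intervalIntegral.integral_of_le hs]
  have hi := Real.GammaIntegral_convergent (s := 1 + α) (by linarith)
  simp only [add_sub_cancel_left] at hi ⊢
  simp only [mul_comm (Real.exp _)] at hi ⊢
  refine setIntegral_mono_set hi ?_ Set.Ioc_subset_Ioi_self.eventuallyLE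
  filter_upwards [ae_restrict_mem measurableSet_Ioi] with t ht
  have := Real.rpow_nonneg (Set.mem_Ioi.1 ht).le α
  simp only [Pi.zero_apply]
  positivity

theorem Gamma_two_add {α : ℝ} (hα : 0 < α) :
    Real.Gamma (2 + α) = (1 + α) * Real.Gamma (1 + α) := by
  rw [← Real.Gamma_add_one (by positivity)]
  congr 1
  ring

theorem integral_rpow_zero_to {α : ℝ} (hα : 0 < α) (s : ℝ) :
    ∫ t in (0 : ℝ)..s, t ^ α = s ^ (1 + α) / (1 + α) := by
  rw [integral_rpow (Or.inl (by linarith)), Real.zero_rpow (by positivity), sub_zero, add_comm]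

/-- Bound e^{-t} by 1 in the integral. With `le_weight` this fixes the leading coefficient of the
weight at 0, which governs the decay of the symbol at high frequency. -/
theorem weight_le_rpow {α s : ℝ} (hα : 0 < α) (hs : 0 ≤ s) :
    weight α s ≤ s ^ (1 + α) / Real.Gamma (2 + α) := by
  have hG : 0 < Real.Gamma (1 + α) := Real.Gamma_pos_of_pos (by linarith)
  have h : ∫ t in (0 : ℝ)..s, t ^ α * Real.exp (-t) ≤ ∫ t in (0 : ℝ)..s, t ^ α := by
    refine intervalIntegral.integral_mono_on hs
      ((continuous_rpow_mul_exp_neg hα).intervalIntegrable _ _)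
      ((Real.continuous_rpow_const hα.le).intervalIntegrable _ _) fun t ht => ?_
    exact mul_le_of_le_one_right (Real.rpow_nonneg ht.1 _) (Real.exp_le_one_iff.2 (by linarith [ht.1]))
  rw [integral_rpow_zero_to hα] at h
  rw [weight, Gamma_two_add hα, inv_mul_le_iff₀ hG]
  refine h.trans (le_of_eq ?_)
  field_simp

/-- On [0, s] the factor e^{-t} is at least e^{-s}. The loss e^{-s} later only shifts the Laplace
variable by 1. -/
theorem le_weight {α s : ℝ} (hα : 0 < α) (hs : 0 ≤ s) :
    Real.exp (-s) * s ^ (1 + α) / Real.Gamma (2 + α) ≤ weight α s := by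
  have hG : 0 < Real.Gamma (1 + α) := Real.Gamma_pos_of_pos (by linarith)
  have h : ∫ t in (0 : ℝ)..s, t ^ α * Real.exp (-s) ≤
      ∫ t in (0 : ℝ)..s, t ^ α * Real.exp (-t) := by
    refine intervalIntegral.integral_mono_on hs
      (((Real.continuous_rpow_const hα.le).mul continuous_const).intervalIntegrable _ _)
      ((continuous_rpow_mul_exp_neg hα).intervalIntegrable _ _) fun t ht => ?_
    have := Real.rpow_nonneg ht.1 α
    gcongr
    exact ht.2
  rw [intervalIntegral.integral_mul_const, integral_rpow_zero_to hα] at h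
  rw [weight, Gamma_two_add hα, le_inv_mul_iff₀ hG]
  refine le_trans (le_of_eq ?_) h
  field_simp

theorem integrableOn_rpow_mul_exp_neg_mul {a r : ℝ} (ha : -1 < a) (hr : 0 < r) :
    IntegrableOn (fun t : ℝ => t ^ a * Real.exp (-(r * t))) (Set.Ioi 0) := by
  simpa using integrableOn_rpow_mul_exp_neg_mul_rpow ha one_pos hr

theorem integrableOn_weight_mul_exp {α r : ℝ} (hα : 0 < α) (hr : 0 < r) :
    IntegrableOn (fun s : ℝ => weight α s * Real.exp (-(r * s))) (Set.Ioi 0) := by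
  refine Integrable.mono' (integrableOn_rpow_mul_exp_neg_mul (a := 0) (by norm_num) hr) ?_ ?_
  · exact ((continuous_weight hα).mul (by fun_prop)).aestronglyMeasurable
  · filter_upwards [ae_restrict_mem measurableSet_Ioi] with s hs
    have hs : 0 < s := hs
    rw [Real.norm_eq_abs, abs_of_nonneg (mul_nonneg (weight_nonneg hα hs.le) (Real.exp_pos _).le),
      Real.rpow_zero]
    gcongr
    exact weight_le_one hα hs.le

/-- The Laplace transform of the incomplete Gamma function. -/
theorem integral_weight_mul_exp {α r : ℝ} (hα : 0 < α) (hr : 0 < r) :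
    ∫ s in Set.Ioi (0 : ℝ), weight α s * Real.exp (-(r * s)) = r⁻¹ * (1 + r) ^ (-(1 + α)) := by
  have hG : 0 < Real.Gamma (1 + α) := Real.Gamma_pos_of_pos (by linarith)
  have hE : ∀ s : ℝ, (Real.Gamma (1 + α))⁻¹ * (s ^ α * Real.exp (-s)) *
      (-r⁻¹ * Real.exp (-(r * s))) =
      (-r⁻¹ * (Real.Gamma (1 + α))⁻¹) * (s ^ α * Real.exp (-((1 + r) * s))) := fun s => by
    rw [show -((1 + r) * s) = -s + -(r * s) by ring, Real.exp_add]
    ring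
  -- Integration by parts against -r⁻¹e^{-rs}. The boundary terms vanish because the weight is 0 at
  -- 0 and bounded at infinity, and a Gamma integral with rate 1 + r remains.
  have h := integral_Ioi_mul_deriv_eq_deriv_mul (a := (0 : ℝ)) (a' := (0 : ℝ)) (b' := (0 : ℝ))
    (u := weight α) (v := fun s => -r⁻¹ * Real.exp (-(r * s)))
    (u' := fun s => (Real.Gamma (1 + α))⁻¹ * (s ^ α * Real.exp (-s)))
    (v' := fun s => Real.exp (-(r * s)))
    (fun s _ => hasDerivAt_weight hα s) (fun s _ => ?_) (integrableOn_weight_mul_exp hα hr) ?_ ?_ ?_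
  · rw [h]
    have h2 := Real.integral_rpow_mul_exp_neg_mul_Ioi (a := 1 + α) (r := 1 + r) (by linarith)
      (by linarith)
    rw [add_sub_cancel_left] at h2
    simp only [hE]
    rw [integral_const_mul, h2, one_div, Real.inv_rpow (by positivity),
      Real.rpow_neg (by positivity)]
    field_simp
    ring
  · have h1 : HasDerivAt (fun s : ℝ => -(r * s)) (-(r * 1)) s := ((hasDerivAt_id s).const_mul r).neg
    convert (h1.exp.const_mul (-r⁻¹)) using 1
    field_simp
  · simp only [Pi.mul_def, hE]
    exact (integrableOn_rpow_mul_exp_neg_mul (by linarith) (by linarith)).const_mul _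
  · have hc : Continuous (weight α * fun s => -r⁻¹ * Real.exp (-(r * s))) :=
      (continuous_weight hα).mul (by fun_prop)
    have := hc.tendsto 0
    simp only [Pi.mul_apply, weight_zero, zero_mul] at this
    exact this.mono_left nhdsWithin_le_nhds
  · have h0 : Filter.Tendsto (fun s : ℝ => r⁻¹ * Real.exp (-(r * s))) Filter.atTop (nhds 0) := by
      rw [← mul_zero r⁻¹]
      exact (Real.tendsto_exp_neg_atTop_nhds_zero.comp
        (Filter.tendsto_id.const_mul_atTop hr)).const_mul _
    refine squeeze_zero_norm' ?_ h0
    filter_upwards [Filter.eventually_ge_atTop 0] with s hs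
    rw [Pi.mul_apply, norm_mul, norm_mul, norm_neg, Real.norm_eq_abs, Real.norm_eq_abs,
      Real.norm_eq_abs, abs_of_nonneg (weight_nonneg hα hs), abs_of_pos (inv_pos.2 hr),
      abs_of_pos (Real.exp_pos _)]
    exact mul_le_of_le_one_left (by positivity) (weight_le_one hα hs)

/-! ### Gaussian integrals and moments on the plane -/

theorem integrable_gaussian {s : ℝ} (hs : 0 < s) :
    Integrable fun m : Plane => Real.exp (-(s * ‖m‖ ^ 2)) := by
  have h := (GaussianFourier.integrable_cexp_neg_mul_sq_norm_add (V := Plane) (b := (s : ℂ))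
    (by simpa using hs) 0 0).re
  refine h.congr (Filter.Eventually.of_forall fun m => ?_)
  simp only [zero_mul, add_zero, RCLike.re_to_complex]
  rw [show (-(s : ℂ) * (‖m‖ : ℂ) ^ 2) = ((-(s * ‖m‖ ^ 2) : ℝ) : ℂ) by push_cast; ring,
    Complex.exp_ofReal_re]

theorem integral_gaussian_plane {s : ℝ} (hs : 0 < s) :
    ∫ m : Plane, Real.exp (-(s * ‖m‖ ^ 2)) = Real.pi / s := by
  have h := GaussianFourier.integral_rexp_neg_mul_sq_norm (V := Plane) hs
  simpa using h

theorem integrable_mul_gaussian {s C : ℝ} (hs : 0 < s) {h : Plane → ℝ} (hc : Continuous h)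
    (hb : ∀ m, |h m| ≤ C * (1 + ‖m‖ ^ 2)) :
    Integrable fun m : Plane => h m * Real.exp (-(s * ‖m‖ ^ 2)) := by
  refine ((integrable_gaussian (half_pos hs)).const_mul (C * (1 + 2 / s))).mono'
    (hc.mul (by fun_prop)).aestronglyMeasurable (Filter.Eventually.of_forall fun m => ?_)
  have hC : 0 ≤ C := by
    by_contra! hC
    have := (abs_nonneg _).trans (hb 0)
    simp at this
    linarith
  rw [norm_mul, Real.norm_eq_abs, Real.norm_eq_abs, abs_of_pos (Real.exp_pos _)]
  -- One half of the Gaussian absorbs the quadratic growth, the other half stays as the integrable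
  -- majorant.
  have h1 : Real.exp (-(s * ‖m‖ ^ 2)) =
      Real.exp (-(s / 2 * ‖m‖ ^ 2)) * Real.exp (-(s / 2 * ‖m‖ ^ 2)) := by
    rw [← Real.exp_add]; ring_nf
  have h2 : (1 + ‖m‖ ^ 2) * Real.exp (-(s / 2 * ‖m‖ ^ 2)) ≤ 1 + 2 / s := by
    have h3 := Real.add_one_le_exp (s / 2 * ‖m‖ ^ 2)
    have h4 : Real.exp (s / 2 * ‖m‖ ^ 2) * Real.exp (-(s / 2 * ‖m‖ ^ 2)) = 1 := by
      rw [← Real.exp_add]; simp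
    have h5 : Real.exp (-(s / 2 * ‖m‖ ^ 2)) ≤ 1 := Real.exp_le_one_iff.2 (by
      have : 0 ≤ s / 2 * ‖m‖ ^ 2 := by positivity
      linarith)
    have h6 : s / 2 * ‖m‖ ^ 2 * Real.exp (-(s / 2 * ‖m‖ ^ 2)) ≤ 1 := by
      rw [← h4]; gcongr; linarith
    have h7 : ‖m‖ ^ 2 * Real.exp (-(s / 2 * ‖m‖ ^ 2)) ≤ 2 / s := by
      rw [le_div_iff₀ hs]; linarith
    linarith
  rw [h1, ← mul_assoc]
  refine mul_le_mul_of_nonneg_right ?_ (Real.exp_pos _).le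
  calc |h m| * Real.exp (-(s / 2 * ‖m‖ ^ 2))
      ≤ C * (1 + ‖m‖ ^ 2) * Real.exp (-(s / 2 * ‖m‖ ^ 2)) := by gcongr; exact hb m
    _ ≤ C * (1 + 2 / s) := by rw [mul_assoc]; gcongr

theorem integral_gaussian_mul_cos {s : ℝ} (hs : 0 < s) (y : Plane) :
    ∫ m : Plane, Real.exp (-(s * ‖m‖ ^ 2)) * Real.cos (2 * Real.pi * inner ℝ m y) =
      Real.pi / s * Real.exp (-(Real.pi ^ 2 * ‖y‖ ^ 2 / s)) := by
  have h := fourier_gaussian_innerProductSpace (V := Plane) (b := (s : ℂ)) (by simpa using hs) y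
  have hr := congrArg Complex.re h
  rw [Real.fourier_eq', ← RCLike.re_to_complex, ← integral_re] at hr
  · convert! hr using 1
    · congr 1
      funext m
      rw [show (-(s : ℂ) * (‖m‖ : ℂ) ^ 2) = ((-(s * ‖m‖ ^ 2) : ℝ) : ℂ) by push_cast; ring,
        smul_eq_mul, ← Complex.ofReal_exp, RCLike.re_to_complex, mul_comm (Complex.exp _),
        Complex.re_ofReal_mul, Complex.exp_ofReal_mul_I_re, ← Real.cos_neg]
      ring_nf
    · rw [show ((Module.finrank ℝ Plane : ℕ) : ℂ) / 2 = 1 by simp, Complex.cpow_one,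
        show (-(Real.pi : ℂ) ^ 2 * (‖y‖ : ℂ) ^ 2 / s) =
          ((-(Real.pi ^ 2 * ‖y‖ ^ 2 / s) : ℝ) : ℂ) by push_cast; ring,
        ← Complex.ofReal_exp, ← Complex.ofReal_div, ← Complex.ofReal_mul, Complex.ofReal_re]
  · have := (GaussianFourier.integrable_cexp_neg_mul_sq_norm_add (V := Plane) (b := (s : ℂ))
      (by simpa using hs) (-2 * Real.pi * Complex.I) y)
    refine this.congr (Filter.Eventually.of_forall fun m => ?_)
    simp only [smul_eq_mul]
    rw [← Complex.exp_add, real_inner_comm]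
    congr 1
    push_cast
    ring

theorem hasFDerivAt_gaussian (s : ℝ) (m : Plane) :
    HasFDerivAt (fun m : Plane => Real.exp (-(s * ‖m‖ ^ 2)))
      ((-(2 * s) * Real.exp (-(s * ‖m‖ ^ 2))) • innerSL ℝ m) m := by
  have h : HasFDerivAt (fun m : Plane => Real.exp (-(s * ‖m‖ ^ 2)))
      (Real.exp (-(s * ‖m‖ ^ 2)) • (-(s • (2 • innerSL ℝ m)) : Plane →L[ℝ] ℝ)) m :=
    ((((hasStrictFDerivAt_norm_sq m).hasFDerivAt).const_mul s).neg).exp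
  refine h.congr_fderiv ?_
  ext w
  simp
  ring

theorem hasFDerivAt_phase (y m : Plane) :
    HasFDerivAt (fun m : Plane => 2 * Real.pi * inner ℝ m y) ((2 * Real.pi) • innerSL ℝ y) m := by
  have h := ((innerSL ℝ y).hasFDerivAt (x := m)).const_mul (2 * Real.pi)
  simpa [real_inner_comm] using h

theorem abs_inner_mul_le (m v : Plane) : |inner ℝ m v| ≤ ‖v‖ * (1 + ‖m‖ ^ 2) := by
  have h := abs_real_inner_le_norm m v
  have : ‖m‖ ≤ 1 + ‖m‖ ^ 2 := by nlinarith [sq_nonneg (‖m‖ - 1), sq_nonneg ‖m‖]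
  nlinarith [norm_nonneg v]

theorem abs_inner_mul_inner_le (m v w : Plane) :
    |inner ℝ m v * inner ℝ m w| ≤ ‖v‖ * ‖w‖ * (1 + ‖m‖ ^ 2) := by
  rw [abs_mul]
  calc |inner ℝ m v| * |inner ℝ m w| ≤ (‖m‖ * ‖v‖) * (‖m‖ * ‖w‖) := by
        gcongr <;> exact abs_real_inner_le_norm _ _
    _ ≤ ‖v‖ * ‖w‖ * (1 + ‖m‖ ^ 2) := by nlinarith [mul_nonneg (norm_nonneg v) (norm_nonneg w)]

theorem abs_mul_le_of_abs_le_one {a b c : ℝ} (ha : |a| ≤ c) (hb : |b| ≤ 1) : |a * b| ≤ c := by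
  rw [abs_mul]
  exact (mul_le_of_le_one_right (abs_nonneg _) hb).trans ha

/-- The factor (m·v)e^{-s|m|²} is -(2s)⁻¹ times the derivative of the Gaussian along v. Integration
by parts moves this derivative onto the sine and leaves the cosine transform of the Gaussian. -/
theorem integral_inner_mul_gaussian_mul_sin {s : ℝ} (hs : 0 < s) (y v : Plane) :
    ∫ m : Plane, inner ℝ m v * Real.exp (-(s * ‖m‖ ^ 2)) * Real.sin (2 * Real.pi * inner ℝ m y) =
      Real.pi * inner ℝ y v / s * (Real.pi / s * Real.exp (-(Real.pi ^ 2 * ‖y‖ ^ 2 / s))) := by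
  have hf : ∀ m : Plane, fderiv ℝ (fun m : Plane => Real.exp (-(s * ‖m‖ ^ 2))) m v =
      -(2 * s) * (inner ℝ m v * Real.exp (-(s * ‖m‖ ^ 2))) := fun m => by
    rw [(hasFDerivAt_gaussian s m).fderiv]
    simp
    ring
  have hg : ∀ m : Plane, fderiv ℝ (fun m : Plane => Real.sin (2 * Real.pi * inner ℝ m y)) m v =
      2 * Real.pi * inner ℝ y v * Real.cos (2 * Real.pi * inner ℝ m y) := fun m => by
    rw [(hasFDerivAt_phase y m).sin.fderiv]
    simp
    ring
  have h := integral_mul_fderiv_eq_neg_fderiv_mul_of_integrable (μ := (volume : Measure Plane))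
    (f := fun m : Plane => Real.exp (-(s * ‖m‖ ^ 2)))
    (g := fun m : Plane => Real.sin (2 * Real.pi * inner ℝ m y)) (v := v) ?_ ?_ ?_
    (fun m _ => (hasFDerivAt_gaussian s m).differentiableAt)
    (fun m _ => (hasFDerivAt_phase y m).sin.differentiableAt)
  · simp only [hf, hg] at h
    have h1 : (2 * Real.pi * inner ℝ y v) *
        ∫ m : Plane, Real.exp (-(s * ‖m‖ ^ 2)) * Real.cos (2 * Real.pi * inner ℝ m y) =
        (2 * s) * ∫ m : Plane, inner ℝ m v * Real.exp (-(s * ‖m‖ ^ 2)) *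
          Real.sin (2 * Real.pi * inner ℝ m y) := by
      rw [← integral_const_mul, ← integral_const_mul]
      convert h using 1
      · congr 1; funext m; ring
      · rw [← integral_neg]; congr 1; funext m; ring
    rw [integral_gaussian_mul_cos hs] at h1
    field_simp at h1 ⊢
    linarith
  · simp only [hf]
    refine ((integrable_mul_gaussian (C := ‖v‖) hs (h := fun m : Plane => inner ℝ m v *
      Real.sin (2 * Real.pi * inner ℝ m y)) (by fun_prop) fun m =>
        abs_mul_le_of_abs_le_one (abs_inner_mul_le m v) (Real.abs_sin_le_one _)).const_mul
          (-(2 * s))).congr (Filter.Eventually.of_forall fun m => ?_)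
    simp only
    ring
  · simp only [hg]
    refine ((integrable_mul_gaussian (C := 1) hs (h := fun m : Plane =>
      Real.cos (2 * Real.pi * inner ℝ m y)) (by fun_prop) fun m =>
        (Real.abs_cos_le_one _).trans (by nlinarith [sq_nonneg ‖m‖])).const_mul
          (2 * Real.pi * inner ℝ y v)).congr (Filter.Eventually.of_forall fun m => ?_)
    simp only
    ring
  · refine (integrable_mul_gaussian (C := 1) hs (h := fun m : Plane =>
      Real.sin (2 * Real.pi * inner ℝ m y)) (by fun_prop) fun m =>
        (Real.abs_sin_le_one _).trans (by nlinarith [sq_nonneg ‖m‖])).congr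
          (Filter.Eventually.of_forall fun m => ?_)
    simp only
    ring

/-- Integration by parts once more. Differentiating the extra factor m·w produces the term in v·w,
and differentiating the cosine leads back to the first sine moment. -/
theorem integral_inner_mul_inner_mul_gaussian_mul_cos {s : ℝ} (hs : 0 < s) (y v w : Plane) :
    ∫ m : Plane, inner ℝ m v * inner ℝ m w * Real.exp (-(s * ‖m‖ ^ 2)) *
        Real.cos (2 * Real.pi * inner ℝ m y) =
      (inner ℝ v w / (2 * s) - Real.pi ^ 2 * inner ℝ y v * inner ℝ y w / s ^ 2) *
        (Real.pi / s * Real.exp (-(Real.pi ^ 2 * ‖y‖ ^ 2 / s))) := by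
  have hd : ∀ m : Plane, HasFDerivAt (fun m : Plane => inner ℝ m w * Real.exp (-(s * ‖m‖ ^ 2)))
      ((inner ℝ m w) • ((-(2 * s) * Real.exp (-(s * ‖m‖ ^ 2))) • innerSL ℝ m) +
        Real.exp (-(s * ‖m‖ ^ 2)) • innerSL ℝ w) m := fun m => by
    have h1 : HasFDerivAt (fun m : Plane => inner ℝ m w) (innerSL ℝ w) m := by
      have h := (innerSL ℝ w).hasFDerivAt (x := m)
      simpa [real_inner_comm] using h
    exact h1.mul (hasFDerivAt_gaussian s m)
  have hf : ∀ m : Plane, fderiv ℝ (fun m : Plane => inner ℝ m w * Real.exp (-(s * ‖m‖ ^ 2))) m v =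
      inner ℝ v w * Real.exp (-(s * ‖m‖ ^ 2)) -
        (2 * s) * (inner ℝ m v * inner ℝ m w * Real.exp (-(s * ‖m‖ ^ 2))) := fun m => by
    rw [(hd m).fderiv]
    simp [real_inner_comm]
    ring
  have hg : ∀ m : Plane, fderiv ℝ (fun m : Plane => Real.cos (2 * Real.pi * inner ℝ m y)) m v =
      -(2 * Real.pi * inner ℝ y v) * Real.sin (2 * Real.pi * inner ℝ m y) := fun m => by
    rw [(hasFDerivAt_phase y m).cos.fderiv]
    simp
    ring
  have i1 : Integrable fun m : Plane => Real.exp (-(s * ‖m‖ ^ 2)) *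
      Real.cos (2 * Real.pi * inner ℝ m y) := by
    refine (integrable_mul_gaussian (C := 1) hs (h := fun m : Plane =>
      Real.cos (2 * Real.pi * inner ℝ m y)) (by fun_prop) fun m =>
        (Real.abs_cos_le_one _).trans (by nlinarith [sq_nonneg ‖m‖])).congr
          (Filter.Eventually.of_forall fun m => ?_)
    simp only
    ring
  have i2 : Integrable fun m : Plane => inner ℝ m v * inner ℝ m w * Real.exp (-(s * ‖m‖ ^ 2)) *
      Real.cos (2 * Real.pi * inner ℝ m y) := by
    refine (integrable_mul_gaussian (C := ‖v‖ * ‖w‖) hs (h := fun m : Plane =>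
      inner ℝ m v * inner ℝ m w * Real.cos (2 * Real.pi * inner ℝ m y)) (by fun_prop) fun m =>
        abs_mul_le_of_abs_le_one (abs_inner_mul_inner_le m v w) (Real.abs_cos_le_one _)).congr
          (Filter.Eventually.of_forall fun m => ?_)
    simp only
    ring
  have h := integral_mul_fderiv_eq_neg_fderiv_mul_of_integrable (μ := (volume : Measure Plane))
    (f := fun m : Plane => inner ℝ m w * Real.exp (-(s * ‖m‖ ^ 2)))
    (g := fun m : Plane => Real.cos (2 * Real.pi * inner ℝ m y)) (v := v) ?_ ?_ ?_
    (fun m _ => (hd m).differentiableAt)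
    (fun m _ => (hasFDerivAt_phase y m).cos.differentiableAt)
  · simp only [hf, hg] at h
    have h1 : -(2 * Real.pi * inner ℝ y v) *
        ∫ m : Plane, inner ℝ m w * Real.exp (-(s * ‖m‖ ^ 2)) *
          Real.sin (2 * Real.pi * inner ℝ m y) =
        (2 * s) * (∫ m : Plane, inner ℝ m v * inner ℝ m w * Real.exp (-(s * ‖m‖ ^ 2)) *
          Real.cos (2 * Real.pi * inner ℝ m y)) - inner ℝ v w *
        ∫ m : Plane, Real.exp (-(s * ‖m‖ ^ 2)) * Real.cos (2 * Real.pi * inner ℝ m y) := by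
      rw [← integral_const_mul, ← integral_const_mul, ← integral_const_mul,
        ← integral_sub (i2.const_mul _) (i1.const_mul _)]
      convert h using 1
      · congr 1; funext m; ring
      · rw [← integral_neg]; congr 1; funext m; ring
    rw [integral_gaussian_mul_cos hs, integral_inner_mul_gaussian_mul_sin hs] at h1
    field_simp at h1 ⊢
    linarith
  · simp only [hf]
    refine ((i1.const_mul (inner ℝ v w)).sub (i2.const_mul (2 * s))).congr
      (Filter.Eventually.of_forall fun m => ?_)
    simp only [Pi.sub_apply]
    ring
  · simp only [hg]
    refine ((integrable_mul_gaussian (C := ‖w‖) hs (h := fun m : Plane => inner ℝ m w *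
      Real.sin (2 * Real.pi * inner ℝ m y)) (by fun_prop) fun m =>
        abs_mul_le_of_abs_le_one (abs_inner_mul_le m w) (Real.abs_sin_le_one _)).const_mul
          (-(2 * Real.pi * inner ℝ y v))).congr (Filter.Eventually.of_forall fun m => ?_)
    simp only
    ring
  · refine (integrable_mul_gaussian (C := ‖w‖) hs (h := fun m : Plane => inner ℝ m w *
      Real.cos (2 * Real.pi * inner ℝ m y)) (by fun_prop) fun m =>
        abs_mul_le_of_abs_le_one (abs_inner_mul_le m w) (Real.abs_cos_le_one _)).congr
          (Filter.Eventually.of_forall fun m => ?_)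
    simp only
    ring

/-! ### Derivatives of the Green kernel -/

theorem hasFDerivAt_G {x : Plane} (hx : x ≠ 0) :
    HasFDerivAt G ((-(1 / (2 * Real.pi)) * (‖x‖ ^ 2)⁻¹) • innerSL ℝ x) x := by
  have h0 : G = fun y => -(1 / (4 * Real.pi)) * Real.log (‖y‖ ^ 2) := by
    funext y
    rw [G, Real.log_pow]
    push_cast
    field_simp
    ring
  have h1 : HasFDerivAt (fun y : Plane => -(1 / (4 * Real.pi)) * Real.log (‖y‖ ^ 2))
      (-(1 / (4 * Real.pi)) • (‖x‖ ^ 2)⁻¹ • (2 • innerSL ℝ x : Plane →L[ℝ] ℝ)) x :=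
    (((hasStrictFDerivAt_norm_sq x).hasFDerivAt).log (by simpa using hx)).const_mul _
  rw [h0]
  refine h1.congr_fderiv ?_
  ext w
  simp
  field_simp
  ring

theorem hessian_G_apply {x : Plane} (hx : x ≠ 0) (i j : Fin 2) :
    hessian G x i j = -(1 / (2 * Real.pi)) *
      ((1 : Matrix (Fin 2) (Fin 2) ℝ) i j * (‖x‖ ^ 2)⁻¹ - 2 * (x i * x j) * (‖x‖ ^ 2)⁻¹ ^ 2) := by
  have hn : ‖x‖ ^ 2 ≠ 0 := by simpa using hx
  have hG : ContDiffAt ℝ 2 G x :=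
    contDiffAt_const.mul ((contDiffAt_norm ℝ hx).log (by simpa using hx))
  have hd : DifferentiableAt ℝ (fderiv ℝ G) x :=
    (hG.fderiv_right (m := 1) (by norm_num)).differentiableAt (by norm_num)
  set v : Plane := EuclideanSpace.single i (1 : ℝ) with hv
  set w : Plane := EuclideanSpace.single j (1 : ℝ) with hw
  have h1 : fderiv ℝ (fderiv ℝ G) x v w = fderiv ℝ (fun y => fderiv ℝ G y w) x v := by
    rw [fderiv_clm_apply hd (differentiableAt_const _)]
    simp
  -- The gradient formula is available only off the origin; equality near x suffices for the second
  -- derivative.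
  have h2 : (fun y => fderiv ℝ G y w) =ᶠ[nhds x]
      fun y => -(1 / (2 * Real.pi)) * ((‖y‖ ^ 2)⁻¹ * inner ℝ w y) := by
    filter_upwards [isOpen_ne.mem_nhds hx] with y hy
    rw [(hasFDerivAt_G hy).fderiv]
    simp [real_inner_comm]
    ring
  have h4 : HasFDerivAt (fun y : Plane => (‖y‖ ^ 2)⁻¹)
      (-((‖x‖ ^ 2) ^ 2)⁻¹ • (2 • innerSL ℝ x : Plane →L[ℝ] ℝ)) x :=
    (hasDerivAt_inv hn).comp_hasFDerivAt x (hasStrictFDerivAt_norm_sq x).hasFDerivAt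
  have h3 : HasFDerivAt (fun y : Plane => -(1 / (2 * Real.pi)) * ((‖y‖ ^ 2)⁻¹ * inner ℝ w y)) _ x :=
    (h4.mul (innerSL ℝ w).hasFDerivAt).const_mul (-(1 / (2 * Real.pi)))
  change iteratedFDeriv ℝ 2 G x ![v, w] = _
  rw [iteratedFDeriv_two_apply]
  simp only [Matrix.cons_val_zero, Matrix.cons_val_one]
  rw [h1, h2.fderiv_eq, h3.fderiv]
  have e1 : inner ℝ w v = (1 : Matrix (Fin 2) (Fin 2) ℝ) i j := by
    simp [hv, hw, Matrix.one_apply, EuclideanSpace.inner_single_left, eq_comm]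
  have e2 : inner ℝ x v = x i := by simp [hv, EuclideanSpace.inner_single_right]
  have e3 : inner ℝ w x = x j := by simp [hw, EuclideanSpace.inner_single_left]
  simp [e1, e2, e3]
  field_simp
  ring

/-! ### Gaussian mixture form of Q and of its contraction with the Hessian -/

/-- Near 0 the integrand is O(s^{α-1}), and at infinity it is at most s⁻² because the weight is
bounded. This is the majorant behind most of the later integrability claims. -/
theorem integrableOn_weight_mul_inv_sq {α : ℝ} (hα : 0 < α) :
    IntegrableOn (fun s : ℝ => weight α s * (s ^ 2)⁻¹) (Set.Ioi 0) := by
  have hm : AEStronglyMeasurable (fun s : ℝ => weight α s * (s ^ 2)⁻¹) :=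
    ((continuous_weight hα).measurable.mul (by fun_prop)).aestronglyMeasurable
  have hG : 0 < Real.Gamma (2 + α) := Real.Gamma_pos_of_pos (by linarith)
  rw [← Set.Ioc_union_Ioi_eq_Ioi zero_le_one]
  refine IntegrableOn.union ?_ ?_
  · have h : IntegrableOn (fun s : ℝ => (Real.Gamma (2 + α))⁻¹ * s ^ (α - 1)) (Set.Ioc 0 1) :=
      ((intervalIntegrable_iff_integrableOn_Ioc_of_le zero_le_one).1
        (intervalIntegral.intervalIntegrable_rpow' (by linarith))).const_mul _
    refine h.mono' hm.restrict ?_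
    filter_upwards [ae_restrict_mem measurableSet_Ioc] with s hs
    have hw := weight_nonneg hα hs.1.le
    rw [Real.norm_eq_abs, abs_of_nonneg (by positivity)]
    have h1 : s ^ (1 + α) = s ^ (α - 1) * s ^ 2 := by
      rw [← Real.rpow_natCast s 2, ← Real.rpow_add hs.1]
      congr 1
      push_cast
      ring
    have hs2 : 0 < s ^ 2 := pow_pos hs.1 2
    rw [← div_eq_mul_inv, div_le_iff₀ hs2]
    refine (weight_le_rpow hα hs.1.le).trans (le_of_eq ?_)
    rw [h1]
    ring
  · have h : IntegrableOn (fun s : ℝ => s ^ (-2 : ℝ)) (Set.Ioi 1) :=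
      integrableOn_Ioi_rpow_of_lt (by norm_num) one_pos
    refine h.mono' hm.restrict ?_
    filter_upwards [ae_restrict_mem measurableSet_Ioi] with s hs
    have hs : 1 < s := hs
    have hs0 : 0 < s := by linarith
    have hw := weight_nonneg hα hs0.le
    rw [Real.norm_eq_abs, abs_of_nonneg (by positivity), Real.rpow_neg hs0.le]
    norm_cast
    exact mul_le_of_le_one_left (by positivity) (weight_le_one hα hs0.le)

/-- The integral of the weighted Gaussians `s⁻³ e^{-π²|x|²/s}`; up to a constant factor it is the
contraction `tr[(Q(0) - Q(x)) D²G(x)]`. -/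
def gaussianMixture (α : ℝ) (x : Plane) : ℝ :=
  ∫ s in Set.Ioi (0 : ℝ), weight α s * (s ^ 3)⁻¹ * Real.exp (-(Real.pi ^ 2 * ‖x‖ ^ 2 / s))

theorem integrableOn_weight_mul_inv_sq_mul_exp {α c : ℝ} (hα : 0 < α) (hc : 0 ≤ c) :
    IntegrableOn (fun s : ℝ => weight α s * (s ^ 2)⁻¹ * Real.exp (-(c / s))) (Set.Ioi 0) := by
  refine (integrableOn_weight_mul_inv_sq hα).mono'
    (((continuous_weight hα).measurable.mul (by fun_prop)).mul
      (by fun_prop)).aestronglyMeasurable ?_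
  filter_upwards [ae_restrict_mem measurableSet_Ioi] with s hs
  have hs : 0 < s := hs
  have hw := weight_nonneg hα hs.le
  rw [Real.norm_eq_abs, abs_of_nonneg (by positivity)]
  refine mul_le_of_le_one_right (by positivity) (Real.exp_le_one_iff.2 ?_)
  have : 0 ≤ c / s := by positivity
  linarith

/-- The additional s⁻¹ is paid for by (c/s)e^{-c/s} ≤ 1, which is why c must be strictly positive.
-/
theorem integrableOn_weight_mul_inv_cube_mul_exp {α c : ℝ} (hα : 0 < α) (hc : 0 < c) :
    IntegrableOn (fun s : ℝ => weight α s * (s ^ 3)⁻¹ * Real.exp (-(c / s))) (Set.Ioi 0) := by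
  refine ((integrableOn_weight_mul_inv_sq hα).const_mul c⁻¹).mono'
    (((continuous_weight hα).measurable.mul (by fun_prop)).mul
      (by fun_prop)).aestronglyMeasurable ?_
  filter_upwards [ae_restrict_mem measurableSet_Ioi] with s hs
  have hs : 0 < s := hs
  have hw := weight_nonneg hα hs.le
  rw [Real.norm_eq_abs, abs_of_nonneg (by positivity)]
  have h1 : c / s * Real.exp (-(c / s)) ≤ 1 := by
    rw [Real.exp_neg, ← div_eq_mul_inv, div_le_one (Real.exp_pos _)]
    linarith [Real.add_one_le_exp (c / s)]
  calc weight α s * (s ^ 3)⁻¹ * Real.exp (-(c / s))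
      = c⁻¹ * (weight α s * (s ^ 2)⁻¹) * (c / s * Real.exp (-(c / s))) := by
        field_simp
    _ ≤ c⁻¹ * (weight α s * (s ^ 2)⁻¹) := mul_le_of_le_one_right (by positivity) h1

theorem bracket_rpow (m : Plane) (a : ℝ) : bracket m ^ a = (1 + ‖m‖ ^ 2) ^ (a / 2) := by
  rw [bracket, Real.sqrt_eq_rpow, ← Real.rpow_mul (by positivity)]
  ring_nf

theorem Q_apply {α : ℝ} (hα : 0 < α) (y : Plane) (i j : Fin 2) :
    Q α y i j = ∫ m : Plane, Qhat α m i j * Real.cos (2 * Real.pi * inner ℝ m y) := by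
  change (𝓕⁻ (fun n : Plane => (Qhat α n i j : ℂ)) y).re = _
  rw [Real.fourierInv_eq', ← RCLike.re_to_complex, ← integral_re]
  · congr 1
    funext m
    rw [smul_eq_mul, RCLike.re_to_complex, mul_comm, Complex.re_ofReal_mul,
      Complex.exp_ofReal_mul_I_re]
  · refine (Qhat_integrable hα i j).norm.mono' ?_ (Filter.Eventually.of_forall fun m => ?_)
    · have hc : Continuous fun m : Plane =>
          Complex.exp (((2 * Real.pi * inner ℝ m y : ℝ) : ℂ) * Complex.I) := by fun_prop
      exact hc.aestronglyMeasurable.smul (Qhat_integrable hα i j).aestronglyMeasurable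
    · rw [norm_smul, Complex.norm_exp_ofReal_mul_I, one_mul]

/-- Justifies Fubini. Integrating the absolute value in s first gives the Laplace transform, whose
|m|⁻² cancels against |mᵢmⱼ| ≤ |m|²; the integrable function ⟨m⟩^{-(2+2α)} remains as a majorant. -/
theorem integrable_gaussian_prod {α : ℝ} (hα : 0 < α) (y : Plane) (i j : Fin 2) :
    Integrable (Function.uncurry fun (m : Plane) (s : ℝ) => m i * m j *
      Real.cos (2 * Real.pi * inner ℝ m y) * (weight α s * Real.exp (-(‖m‖ ^ 2 * s))))
      ((volume : Measure Plane).prod (volume.restrict (Set.Ioi 0))) := by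
  have hm : AEStronglyMeasurable (Function.uncurry fun (m : Plane) (s : ℝ) => m i * m j *
      Real.cos (2 * Real.pi * inner ℝ m y) * (weight α s * Real.exp (-(‖m‖ ^ 2 * s))))
      ((volume : Measure Plane).prod (volume.restrict (Set.Ioi 0))) := by
    have := continuous_weight hα
    apply Continuous.aestronglyMeasurable
    unfold Function.uncurry
    fun_prop
  have h0 : Integrable (fun n : Plane => ((1 : ℝ) + ‖n‖ ^ 2) ^ (-(2 + 2 * α) / 2)) :=
    integrable_rpow_neg_one_add_norm_sq (by simp [hα])
  have hne : ∀ᵐ m : Plane, m ≠ 0 := by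
    simp [ae_iff]
  rw [integrable_prod_iff hm]
  constructor
  · filter_upwards [hne] with m hm0
    have hr : 0 < ‖m‖ ^ 2 := by positivity
    simp only [Function.uncurry_apply_pair]
    exact (integrableOn_weight_mul_exp hα hr).const_mul _
  · refine h0.mono' hm.norm.integral_prod_right' ?_
    filter_upwards [hne] with m hm0
    have hr : 0 < ‖m‖ ^ 2 := by positivity
    have h1 : ∫ s in Set.Ioi (0 : ℝ), ‖m i * m j * Real.cos (2 * Real.pi * inner ℝ m y) *
        (weight α s * Real.exp (-(‖m‖ ^ 2 * s)))‖ =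
        |m i * m j * Real.cos (2 * Real.pi * inner ℝ m y)| *
          ((‖m‖ ^ 2)⁻¹ * (1 + ‖m‖ ^ 2) ^ (-(1 + α))) := by
      rw [← integral_weight_mul_exp hα hr, ← integral_const_mul]
      refine setIntegral_congr_fun measurableSet_Ioi fun s hs => ?_
      simp only
      rw [norm_mul, Real.norm_eq_abs, Real.norm_eq_abs, abs_of_nonneg (a := weight α s * _)
        (mul_nonneg (weight_nonneg hα (Set.mem_Ioi.1 hs).le) (Real.exp_pos _).le)]
    have h2 : |m i * m j * Real.cos (2 * Real.pi * inner ℝ m y)| ≤ ‖m‖ ^ 2 := by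
      have hi : ∀ k : Fin 2, |m k| ≤ ‖m‖ := fun k => by simpa using PiLp.norm_apply_le m k
      refine abs_mul_le_of_abs_le_one ?_ (Real.abs_cos_le_one _)
      rw [abs_mul, sq]
      gcongr <;> exact hi _
    simp only [Function.uncurry_apply_pair]
    rw [h1, Real.norm_eq_abs, abs_of_nonneg (by positivity), ← mul_assoc,
      show -(2 + 2 * α) / 2 = -(1 + α) by ring]
    refine mul_le_of_le_one_left (by positivity) ?_
    rw [← div_eq_mul_inv, div_le_one hr]
    exact h2

/-- Write the multiplier as a Laplace integral, exchange the integrals, and insert the Gaussian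
second moment: its isotropic term carries s⁻² and its y yᵀ term carries s⁻³. -/
theorem integral_longitudinal {α : ℝ} (hα : 0 < α) (y : Plane) (i j : Fin 2) :
    ∫ m : Plane, m i * m j * Real.cos (2 * Real.pi * inner ℝ m y) *
        ((‖m‖ ^ 2)⁻¹ * (1 + ‖m‖ ^ 2) ^ (-(1 + α))) =
      (1 : Matrix (Fin 2) (Fin 2) ℝ) i j * (Real.pi / 2 * ∫ s in Set.Ioi (0 : ℝ),
          weight α s * (s ^ 2)⁻¹ * Real.exp (-(Real.pi ^ 2 * ‖y‖ ^ 2 / s))) -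
        Real.pi ^ 3 * (y i * y j) * gaussianMixture α y := by
  have hne : ∀ᵐ m : Plane, m ≠ 0 := by
    simp [ae_iff]
  have hi : ∀ (m : Plane) (k : Fin 2), inner ℝ m (EuclideanSpace.single k (1 : ℝ)) = m k :=
    fun m k => by simp [EuclideanSpace.inner_single_right]
  have h1 : ∫ m : Plane, m i * m j * Real.cos (2 * Real.pi * inner ℝ m y) *
        ((‖m‖ ^ 2)⁻¹ * (1 + ‖m‖ ^ 2) ^ (-(1 + α))) =
      ∫ m : Plane, ∫ s in Set.Ioi (0 : ℝ), m i * m j *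
      Real.cos (2 * Real.pi * inner ℝ m y) * (weight α s * Real.exp (-(‖m‖ ^ 2 * s))) := by
    refine integral_congr_ae ?_
    filter_upwards [hne] with m hm0
    rw [integral_const_mul, integral_weight_mul_exp hα (by positivity)]
  have h2 : ∫ s in Set.Ioi (0 : ℝ), ∫ m : Plane, m i * m j *
      Real.cos (2 * Real.pi * inner ℝ m y) * (weight α s * Real.exp (-(‖m‖ ^ 2 * s))) =
      ∫ s in Set.Ioi (0 : ℝ), ((1 : Matrix (Fin 2) (Fin 2) ℝ) i j * (Real.pi / 2) *
        (weight α s * (s ^ 2)⁻¹ * Real.exp (-(Real.pi ^ 2 * ‖y‖ ^ 2 / s))) -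
        Real.pi ^ 3 * (y i * y j) *
          (weight α s * (s ^ 3)⁻¹ * Real.exp (-(Real.pi ^ 2 * ‖y‖ ^ 2 / s)))) := by
    refine setIntegral_congr_fun measurableSet_Ioi fun s hs => ?_
    have hs : 0 < s := hs
    have h := integral_inner_mul_inner_mul_gaussian_mul_cos hs y
      (EuclideanSpace.single i 1) (EuclideanSpace.single j 1)
    simp only [hi] at h
    have h3 : ∫ m : Plane, m i * m j *
        Real.cos (2 * Real.pi * inner ℝ m y) * (weight α s * Real.exp (-(‖m‖ ^ 2 * s))) =
        weight α s * ∫ m : Plane, m i * m j * Real.exp (-(s * ‖m‖ ^ 2)) *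
          Real.cos (2 * Real.pi * inner ℝ m y) := by
      rw [← integral_const_mul]
      congr 1
      funext m
      rw [mul_comm s]
      ring
    have h4 : (EuclideanSpace.single i (1 : ℝ) : Plane) j = (1 : Matrix (Fin 2) (Fin 2) ℝ) i j := by
      simp [Matrix.one_apply, eq_comm]
    simp only
    rw [h3, h, h4]
    field_simp
  rw [h1, integral_integral_swap (integrable_gaussian_prod hα y i j), h2]
  -- At y = 0 the s⁻³ integral need not converge, so the difference cannot be split; there the
  -- coefficient yᵢyⱼ removes that term beforehand.
  by_cases hy : y = 0
  · subst hy
    simp only [PiLp.zero_apply, mul_zero, zero_mul, sub_zero]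
    rw [integral_const_mul, mul_assoc]
  · rw [integral_sub ((integrableOn_weight_mul_inv_sq_mul_exp hα (by positivity)).const_mul _)
      ((integrableOn_weight_mul_inv_cube_mul_exp hα (by positivity)).const_mul _),
      integral_const_mul, integral_const_mul, mul_assoc]
    rfl

/-- The value of q is left open since multiples of the identity are invisible to a traceless
Hessian. -/
theorem Q_apply_eq {α : ℝ} (hα : 0 < α) (y : Plane) : ∃ q : ℝ, ∀ i j : Fin 2,
    Q α y i j = q * (1 : Matrix (Fin 2) (Fin 2) ℝ) i j +
      Real.pi ^ 3 * (y i * y j) * gaussianMixture α y := by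
  have hne : ∀ᵐ m : Plane, m ≠ 0 := by
    simp [ae_iff]
  have h0 : Integrable (fun n : Plane => ((1 : ℝ) + ‖n‖ ^ 2) ^ (-(1 + α))) := by
    have := integrable_rpow_neg_one_add_norm_sq (E := Plane) (μ := volume) (r := 2 + 2 * α)
      (by simp [hα])
    rwa [show -(2 + 2 * α) / 2 = -(1 + α) by ring] at this
  have h1 : Integrable (fun m : Plane => ((1 : ℝ) + ‖m‖ ^ 2) ^ (-(1 + α)) *
      Real.cos (2 * Real.pi * inner ℝ m y)) := by
    refine h0.mono' (h0.aestronglyMeasurable.mul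
      (Continuous.aestronglyMeasurable (by fun_prop))) (Filter.Eventually.of_forall fun m => ?_)
    exact abs_mul_le_of_abs_le_one (abs_of_nonneg (by positivity)).le (Real.abs_cos_le_one _)
  refine ⟨(∫ m : Plane, ((1 : ℝ) + ‖m‖ ^ 2) ^ (-(1 + α)) *
    Real.cos (2 * Real.pi * inner ℝ m y)) - Real.pi / 2 * ∫ s in Set.Ioi (0 : ℝ),
          weight α s * (s ^ 2)⁻¹ * Real.exp (-(Real.pi ^ 2 * ‖y‖ ^ 2 / s)), fun i j => ?_⟩
  have h2 : Integrable (fun m : Plane => m i * m j * Real.cos (2 * Real.pi * inner ℝ m y) *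
        ((‖m‖ ^ 2)⁻¹ * (1 + ‖m‖ ^ 2) ^ (-(1 + α)))) := by
    refine (integrable_gaussian_prod hα y i j).integral_prod_left.congr ?_
    filter_upwards [hne] with m hm0
    simp only [Function.uncurry_apply_pair]
    rw [integral_const_mul, integral_weight_mul_exp hα (by positivity)]
  have h3 : ∀ m : Plane, Qhat α m i j * Real.cos (2 * Real.pi * inner ℝ m y) =
      (1 : Matrix (Fin 2) (Fin 2) ℝ) i j * (((1 : ℝ) + ‖m‖ ^ 2) ^ (-(1 + α)) *
        Real.cos (2 * Real.pi * inner ℝ m y)) -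
      m i * m j * Real.cos (2 * Real.pi * inner ℝ m y) *
        ((‖m‖ ^ 2)⁻¹ * (1 + ‖m‖ ^ 2) ^ (-(1 + α))) := fun m => by
    simp only [Qhat, Matrix.smul_apply, Matrix.sub_apply, Matrix.vecMulVec_apply, smul_eq_mul]
    rw [bracket_rpow, show -(2 + 2 * α) / 2 = -(1 + α) by ring]
    ring
  rw [Q_apply hα]
  simp only [h3]
  rw [integral_sub (h1.const_mul _) h2, integral_const_mul, integral_longitudinal hα]
  ring

/-- The scalar parts cancel because D²G has trace zero. The rest is -π³ times xᵀD²G(x)x = 1/(2π)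
times the mixture. -/
theorem trace_Q_mul_hessian {α : ℝ} (hα : 0 < α) {x : Plane} (hx : x ≠ 0) :
    ((Q α 0 - Q α x) * hessian G x).trace = -(Real.pi ^ 2 / 2) * gaussianMixture α x := by
  obtain ⟨p, hp⟩ := Q_apply_eq hα (0 : Plane)
  obtain ⟨q, hq⟩ := Q_apply_eq hα x
  have hn : ‖x‖ ^ 2 = x 0 ^ 2 + x 1 ^ 2 := by
    rw [EuclideanSpace.real_norm_sq_eq, Fin.sum_univ_two]
  have hn0 : x 0 ^ 2 + x 1 ^ 2 ≠ 0 := by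
    rw [← hn]
    simpa using hx
  simp only [Matrix.trace_fin_two, Matrix.mul_apply, Fin.sum_univ_two, Matrix.sub_apply, hp, hq,
    hessian_G_apply hx, PiLp.zero_apply, hn]
  simp
  field_simp
  ring

/-! ### The Fourier transform of the mixture -/

theorem integrable_gaussianMixture_prod {α : ℝ} (hα : 0 < α) :
    Integrable (Function.uncurry fun (x : Plane) (s : ℝ) =>
      weight α s * (s ^ 3)⁻¹ * Real.exp (-(Real.pi ^ 2 * ‖x‖ ^ 2 / s)))
      ((volume : Measure Plane).prod (volume.restrict (Set.Ioi 0))) := by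
  have hm : AEStronglyMeasurable (Function.uncurry fun (x : Plane) (s : ℝ) =>
      weight α s * (s ^ 3)⁻¹ * Real.exp (-(Real.pi ^ 2 * ‖x‖ ^ 2 / s)))
      ((volume : Measure Plane).prod (volume.restrict (Set.Ioi 0))) := by
    have := (continuous_weight hα).measurable
    apply Measurable.aestronglyMeasurable
    unfold Function.uncurry
    fun_prop
  have hexp : ∀ (x : Plane) (s : ℝ), Real.exp (-(Real.pi ^ 2 * ‖x‖ ^ 2 / s)) =
      Real.exp (-(Real.pi ^ 2 / s * ‖x‖ ^ 2)) := fun x s => by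
    congr 1
    ring
  rw [integrable_prod_iff' hm]
  simp only [Function.uncurry_apply_pair, hexp]
  constructor
  · filter_upwards [ae_restrict_mem measurableSet_Ioi] with s hs
    have hs : 0 < s := hs
    exact (integrable_gaussian (by positivity)).const_mul _
  · have h : IntegrableOn (fun s : ℝ => Real.pi⁻¹ * (weight α s * (s ^ 2)⁻¹)) (Set.Ioi 0) :=
      (integrableOn_weight_mul_inv_sq hα).const_mul _
    refine h.congr ?_
    filter_upwards [ae_restrict_mem measurableSet_Ioi] with s hs
    have hs : 0 < s := hs
    have hw := weight_nonneg hα hs.le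
    have h1 : ∀ x : Plane,
        ‖weight α s * (s ^ 3)⁻¹ * Real.exp (-(Real.pi ^ 2 / s * ‖x‖ ^ 2))‖ =
        weight α s * (s ^ 3)⁻¹ * Real.exp (-(Real.pi ^ 2 / s * ‖x‖ ^ 2)) := fun x => by
      rw [Real.norm_eq_abs, abs_of_nonneg (by positivity)]
    simp only [h1]
    -- The mass of e^{-π²|x|²/s} is s/π, which turns s⁻³ into the integrable s⁻².
    rw [integral_const_mul, integral_gaussian_plane (by positivity)]
    field_simp

theorem integrable_gaussianMixture {α : ℝ} (hα : 0 < α) : Integrable (gaussianMixture α) :=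
  (integrable_gaussianMixture_prod hα).integral_prod_left

/-- Up to the factor `π⁻¹`, the Fourier transform of `gaussianMixture` as a function of `|n|²`. -/
def mixtureSymbol (α r : ℝ) : ℝ :=
  ∫ s in Set.Ioi (0 : ℝ), weight α s * (s ^ 2)⁻¹ * Real.exp (-(r * s))

theorem fourier_gaussian_rexp {s : ℝ} (hs : 0 < s) (n : Plane) :
    ∫ x : Plane, Complex.exp (((-2 * Real.pi * inner ℝ x n : ℝ) : ℂ) * Complex.I) *
      ((Real.exp (-(s * ‖x‖ ^ 2)) : ℝ) : ℂ) =
    ((Real.pi / s * Real.exp (-(Real.pi ^ 2 * ‖n‖ ^ 2 / s)) : ℝ) : ℂ) := by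
  have h := fourier_gaussian_innerProductSpace (V := Plane) (b := (s : ℂ)) (by simpa using hs) n
  rw [Real.fourier_eq', show ((Module.finrank ℝ Plane : ℕ) : ℂ) / 2 = 1 by simp,
    Complex.cpow_one] at h
  push_cast
  convert! h using 1
  · congr 1
    funext x
    rw [smul_eq_mul, neg_mul (s : ℂ)]
    push_cast
    rfl
  · rw [neg_mul]
    ring_nf

/-- Fubini reduces to a single Gaussian: e^{-π²|x|²/s} has transform (s/π)e^{-s|n|²}. -/
theorem fourier_gaussianMixture {α : ℝ} (hα : 0 < α) (n : Plane) :
    𝓕 (fun x : Plane => (gaussianMixture α x : ℂ)) n =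
      ((Real.pi⁻¹ * mixtureSymbol α (‖n‖ ^ 2) : ℝ) : ℂ) := by
  set e : Plane → ℂ := fun x => Complex.exp (((-2 * Real.pi * inner ℝ x n : ℝ) : ℂ) * Complex.I)
    with he
  have hec : Continuous e := by fun_prop
  have hen : ∀ x, ‖e x‖ = 1 := fun x => Complex.norm_exp_ofReal_mul_I _
  set K : Plane → ℝ → ℝ := fun x s =>
    weight α s * (s ^ 3)⁻¹ * Real.exp (-(Real.pi ^ 2 * ‖x‖ ^ 2 / s)) with hK
  have hi : Integrable (Function.uncurry fun (x : Plane) (s : ℝ) => e x * (K x s : ℂ))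
      ((volume : Measure Plane).prod (volume.restrict (Set.Ioi 0))) := by
    have h1 := (integrable_gaussianMixture_prod hα).ofReal (𝕜 := ℂ)
    refine h1.norm.mono' ((hec.comp continuous_fst).aestronglyMeasurable.mul
      h1.aestronglyMeasurable) (Filter.Eventually.of_forall fun p => ?_)
    simp [Function.uncurry, hen, hK]
  have h1 : 𝓕 (fun x : Plane => (gaussianMixture α x : ℂ)) n =
      ∫ x, ∫ s in Set.Ioi (0 : ℝ), e x * (K x s : ℂ) := by
    rw [Real.fourier_eq']
    congr 1
    funext x
    rw [integral_const_mul, integral_complex_ofReal]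
    rfl
  rw [h1, integral_integral_swap hi, mixtureSymbol, ← integral_const_mul, ← integral_complex_ofReal]
  refine setIntegral_congr_fun measurableSet_Ioi fun s hs => ?_
  have hs : 0 < s := hs
  have h2 := fourier_gaussian_rexp (s := Real.pi ^ 2 / s) (by positivity) n
  have h3 : ∀ x, e x * (K x s : ℂ) = ((weight α s * (s ^ 3)⁻¹ : ℝ) : ℂ) *
      (e x * ((Real.exp (-(Real.pi ^ 2 / s * ‖x‖ ^ 2)) : ℝ) : ℂ)) := fun x => by
    simp only [hK]
    rw [show Real.pi ^ 2 * ‖x‖ ^ 2 / s = Real.pi ^ 2 / s * ‖x‖ ^ 2 by ring]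
    push_cast
    ring
  simp only [h3]
  rw [integral_const_mul, h2, ← Complex.ofReal_mul]
  congr 1
  have h4 : Real.pi ^ 2 * ‖n‖ ^ 2 / (Real.pi ^ 2 / s) = ‖n‖ ^ 2 * s := by
    field_simp
  rw [h4]
  field_simp

/-! ### Two-sided bounds for the symbol -/

theorem integrableOn_mixtureSymbol {α r : ℝ} (hα : 0 < α) (hr : 0 ≤ r) :
    IntegrableOn (fun s : ℝ => weight α s * (s ^ 2)⁻¹ * Real.exp (-(r * s))) (Set.Ioi 0) := by
  refine (integrableOn_weight_mul_inv_sq hα).mono'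
    (((continuous_weight hα).measurable.mul (by fun_prop)).mul
      (by fun_prop)).aestronglyMeasurable ?_
  filter_upwards [ae_restrict_mem measurableSet_Ioi] with s hs
  have hs : 0 < s := hs
  have hw := weight_nonneg hα hs.le
  rw [Real.norm_eq_abs, abs_of_nonneg (by positivity)]
  refine mul_le_of_le_one_right (by positivity) (Real.exp_le_one_iff.2 ?_)
  have : 0 ≤ r * s := by positivity
  linarith

theorem mixtureSymbol_nonneg {α : ℝ} (hα : 0 < α) (r : ℝ) : 0 ≤ mixtureSymbol α r := by
  refine setIntegral_nonneg measurableSet_Ioi fun s hs => ?_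
  have := weight_nonneg hα (Set.mem_Ioi.1 hs).le
  positivity

theorem mixtureSymbol_anti {α r t : ℝ} (hα : 0 < α) (hr : 0 ≤ r) (hrt : r ≤ t) :
    mixtureSymbol α t ≤ mixtureSymbol α r := by
  refine setIntegral_mono_on (integrableOn_mixtureSymbol hα (hr.trans hrt))
    (integrableOn_mixtureSymbol hα hr) measurableSet_Ioi fun s hs => ?_
  have hs : 0 < s := hs
  have := weight_nonneg hα hs.le
  gcongr

theorem Gamma_div_Gamma_two_add {α : ℝ} (hα : 0 < α) :
    Real.Gamma α / Real.Gamma (2 + α) = 1 / (α * (α + 1)) := by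
  have hG : 0 < Real.Gamma α := Real.Gamma_pos_of_pos hα
  rw [Gamma_two_add hα, add_comm 1 α, Real.Gamma_add_one hα.ne']
  field_simp

theorem integral_rpow_sub_one_mul_exp {α r : ℝ} (hα : 0 < α) (hr : 0 < r) :
    ∫ s in Set.Ioi (0 : ℝ), (Real.Gamma (2 + α))⁻¹ * (s ^ (α - 1) * Real.exp (-(r * s))) =
      1 / (α * (α + 1)) * r ^ (-α) := by
  rw [integral_const_mul, Real.integral_rpow_mul_exp_neg_mul_Ioi hα hr,
    ← Gamma_div_Gamma_two_add hα, one_div, Real.inv_rpow hr.le, Real.rpow_neg hr.le]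
  ring

theorem rpow_one_add_mul_inv_sq {α s : ℝ} (hs : 0 < s) :
    s ^ (1 + α) * (s ^ 2)⁻¹ = s ^ (α - 1) := by
  rw [← div_eq_mul_inv, ← Real.rpow_natCast s 2, ← Real.rpow_sub hs]
  congr 1
  push_cast
  ring

theorem mixtureSymbol_le {α r : ℝ} (hα : 0 < α) (hr : 0 < r) :
    mixtureSymbol α r ≤ 1 / (α * (α + 1)) * r ^ (-α) := by
  rw [← integral_rpow_sub_one_mul_exp hα hr]
  refine setIntegral_mono_on (integrableOn_mixtureSymbol hα hr.le)
    ((integrableOn_rpow_mul_exp_neg_mul (by linarith) hr).const_mul _) measurableSet_Ioi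
    fun s hs => ?_
  have hs : 0 < s := hs
  have h := weight_le_rpow hα hs.le
  rw [← rpow_one_add_mul_inv_sq hs, ← mul_assoc, ← mul_assoc]
  gcongr
  rwa [inv_mul_eq_div]

/-- The factor e^{-s} of `le_weight` replaces r by 1 + r in the Gamma integral. The constant agrees
with the one in `mixtureSymbol_le`, so the leading coefficient at infinity is determined. -/
theorem le_mixtureSymbol {α r : ℝ} (hα : 0 < α) (hr : 0 ≤ r) :
    1 / (α * (α + 1)) * (1 + r) ^ (-α) ≤ mixtureSymbol α r := by
  have hr1 : 0 < 1 + r := by linarith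
  rw [← integral_rpow_sub_one_mul_exp hα hr1]
  refine setIntegral_mono_on
    ((integrableOn_rpow_mul_exp_neg_mul (by linarith) hr1).const_mul _)
    (integrableOn_mixtureSymbol hα hr) measurableSet_Ioi fun s hs => ?_
  have hs : 0 < s := hs
  have h := le_weight hα hs.le
  calc (Real.Gamma (2 + α))⁻¹ * (s ^ (α - 1) * Real.exp (-((1 + r) * s)))
      = Real.exp (-s) * s ^ (1 + α) / Real.Gamma (2 + α) * (s ^ 2)⁻¹ * Real.exp (-(r * s)) := by
        rw [← rpow_one_add_mul_inv_sq hs, show -((1 + r) * s) = -s + -(r * s) by ring,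
          Real.exp_add]
        ring
    _ ≤ weight α s * (s ^ 2)⁻¹ * Real.exp (-(r * s)) := by gcongr

theorem exists_mixtureSymbol_le {α : ℝ} (hα : 0 < α) :
    ∃ K : ℝ, 0 ≤ K ∧ ∀ r : ℝ, 0 ≤ r → (1 + r) ^ α * mixtureSymbol α r ≤ K := by
  refine ⟨2 ^ α * (mixtureSymbol α 0 + 1 / (α * (α + 1))), ?_, fun r hr => ?_⟩
  · have := mixtureSymbol_nonneg hα 0
    positivity
  · have h0 := mixtureSymbol_nonneg hα 0
    have hr0 := mixtureSymbol_nonneg hα r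
    have hc : 0 ≤ 1 / (α * (α + 1)) := by positivity
    -- For r ≤ 1 use monotonicity and 1 + r ≤ 2; for r ≥ 1 use the power bound and 1 + r ≤ 2r.
    rcases le_total r 1 with h | h
    · calc (1 + r) ^ α * mixtureSymbol α r ≤ 2 ^ α * mixtureSymbol α 0 := by
            gcongr
            · linarith
            · exact mixtureSymbol_anti hα le_rfl hr
        _ ≤ _ := by gcongr; linarith
    · have hr1 : 0 < r := by linarith
      calc (1 + r) ^ α * mixtureSymbol α r
          ≤ (2 * r) ^ α * (1 / (α * (α + 1)) * r ^ (-α)) := by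
            gcongr
            · linarith
            · exact mixtureSymbol_le hα hr1
        _ = 2 ^ α * (1 / (α * (α + 1))) := by
            rw [Real.mul_rpow (by norm_num) hr1.le, Real.rpow_neg hr1.le]
            have := (Real.rpow_pos_of_pos hr1 α).ne'
            field_simp
        _ ≤ _ := by gcongr; linarith

/-! ### Evaluation of the coercivity constant -/

theorem one_sub_exp_neg_le {x : ℝ} : 1 - Real.exp (-x) ≤ x := by
  linarith [Real.add_one_le_exp (-x)]

theorem integrableOn_rpow_mul_one_sub_exp {α c : ℝ} (hα0 : 0 < α) (hα1 : α < 1) (hc : 0 < c) :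
    IntegrableOn (fun s : ℝ => (1 - Real.exp (-(c * s))) * s ^ (-1 - α)) (Set.Ioi 0) := by
  have hm : AEStronglyMeasurable (fun s : ℝ => (1 - Real.exp (-(c * s))) * s ^ (-1 - α)) :=
    Measurable.aestronglyMeasurable (by fun_prop)
  rw [← Set.Ioc_union_Ioi_eq_Ioi zero_le_one]
  refine IntegrableOn.union ?_ ?_
  · have h : IntegrableOn (fun s : ℝ => c * s ^ (-α)) (Set.Ioc 0 1) :=
      ((intervalIntegrable_iff_integrableOn_Ioc_of_le zero_le_one).1
        (intervalIntegral.intervalIntegrable_rpow' (by linarith))).const_mul _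
    refine h.mono' hm.restrict ?_
    filter_upwards [ae_restrict_mem measurableSet_Ioc] with s hs
    have hs : 0 < s := hs.1
    have h1 : 0 ≤ 1 - Real.exp (-(c * s)) := sub_nonneg.2 (Real.exp_le_one_iff.2 (by
      have : 0 ≤ c * s := by positivity
      linarith))
    rw [Real.norm_eq_abs, abs_of_nonneg (by positivity)]
    calc (1 - Real.exp (-(c * s))) * s ^ (-1 - α) ≤ (c * s) * s ^ (-1 - α) := by
          gcongr
          exact one_sub_exp_neg_le
      _ = c * s ^ (-α) := by
          rw [mul_assoc, ← Real.rpow_one_add' hs.le (by linarith)]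
          ring_nf
  · refine (integrableOn_Ioi_rpow_of_lt (by linarith : -1 - α < -1) one_pos).mono' hm.restrict ?_
    filter_upwards [ae_restrict_mem measurableSet_Ioi] with s hs
    have hs : 1 < s := hs
    have hs0 : 0 < s := by linarith
    have h1 : 0 ≤ 1 - Real.exp (-(c * s)) := sub_nonneg.2 (Real.exp_le_one_iff.2 (by
      have : 0 ≤ c * s := by positivity
      linarith))
    rw [Real.norm_eq_abs, abs_of_nonneg (by positivity)]
    exact mul_le_of_le_one_left (by positivity) (by linarith [Real.exp_pos (-(c * s))])

/-- Integration by parts reduces to the integral for Γ(1-α). The boundary term is O(s^{1-α}) at 0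
and O(s^{-α}) at infinity, so both ends of 0 < α < 1 matter. -/
theorem integral_rpow_mul_one_sub_exp {α c : ℝ} (hα0 : 0 < α) (hα1 : α < 1) (hc : 0 < c) :
    ∫ s in Set.Ioi (0 : ℝ), (1 - Real.exp (-(c * s))) * s ^ (-1 - α) =
      c ^ α * Real.Gamma (1 - α) / α := by
  have hb : ∀ s : ℝ, 0 < s → 0 ≤ 1 - Real.exp (-(c * s)) := fun s hs =>
    sub_nonneg.2 (Real.exp_le_one_iff.2 (by
      have : 0 ≤ c * s := by positivity
      linarith))
  have hn : ∀ s : ℝ, 0 < s → ‖(1 - Real.exp (-(c * s))) * (-α⁻¹ * s ^ (-α))‖ =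
      (1 - Real.exp (-(c * s))) * (α⁻¹ * s ^ (-α)) := fun s hs => by
    have := hb s hs
    rw [neg_mul, mul_neg, norm_neg, Real.norm_eq_abs, abs_of_nonneg (by positivity)]
  have h := integral_Ioi_mul_deriv_eq_deriv_mul (a := (0 : ℝ)) (a' := (0 : ℝ)) (b' := (0 : ℝ))
    (u := fun s => 1 - Real.exp (-(c * s))) (v := fun s => -α⁻¹ * s ^ (-α))
    (u' := fun s => c * Real.exp (-(c * s))) (v' := fun s => s ^ (-1 - α))
    (fun s _ => ?_) (fun s hs => ?_) (integrableOn_rpow_mul_one_sub_exp hα0 hα1 hc) ?_ ?_ ?_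
  · rw [h]
    have h2 := Real.integral_rpow_mul_exp_neg_mul_Ioi (a := 1 - α) (r := c) (by linarith) hc
    rw [show 1 - α - 1 = -α by ring] at h2
    have hE : ∀ s : ℝ, c * Real.exp (-(c * s)) * (-α⁻¹ * s ^ (-α)) =
        (-α⁻¹ * c) * (s ^ (-α) * Real.exp (-(c * s))) := fun s => by ring
    simp only [hE]
    rw [integral_const_mul, h2, one_div, Real.inv_rpow hc.le, Real.rpow_sub hc, Real.rpow_one]
    field_simp
    ring
  · have h1 : HasDerivAt (fun s : ℝ => -(c * s)) (-(c * 1)) s := ((hasDerivAt_id s).const_mul c).neg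
    refine (h1.exp.const_sub 1).congr_deriv ?_
    ring
  · have hs : 0 < s := hs
    convert ((Real.hasDerivAt_rpow_const (p := -α) (Or.inl hs.ne')).const_mul (-α⁻¹)) using 1
    rw [show -1 - α = -α - 1 by ring]
    field_simp
  · have hE : ((fun s => c * Real.exp (-(c * s))) * fun s => -α⁻¹ * s ^ (-α)) =
        fun s : ℝ => (-α⁻¹ * c) * (s ^ (-α) * Real.exp (-(c * s))) := by
      funext s
      simp only [Pi.mul_apply]
      ring
    rw [hE]
    exact (integrableOn_rpow_mul_exp_neg_mul (by linarith) hc).const_mul _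
  · have h0 : Filter.Tendsto (fun s : ℝ => c * α⁻¹ * s ^ (1 - α)) (nhdsWithin 0 (Set.Ioi 0))
        (nhds 0) := by
      have h1 := ((Real.continuousAt_rpow_const 0 (1 - α) (Or.inr (by linarith))).tendsto).const_mul
        (c * α⁻¹)
      rw [Real.zero_rpow (by linarith), mul_zero] at h1
      exact h1.mono_left nhdsWithin_le_nhds
    refine squeeze_zero_norm' ?_ h0
    filter_upwards [self_mem_nhdsWithin] with s hs
    have hs : 0 < s := hs
    rw [Pi.mul_apply, hn s hs]
    calc (1 - Real.exp (-(c * s))) * (α⁻¹ * s ^ (-α)) ≤ (c * s) * (α⁻¹ * s ^ (-α)) := by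
          gcongr
          exact one_sub_exp_neg_le
      _ = c * α⁻¹ * s ^ (1 - α) := by
          rw [sub_eq_add_neg, Real.rpow_add hs, Real.rpow_one]
          ring
  · have h0 : Filter.Tendsto (fun s : ℝ => α⁻¹ * s ^ (-α)) Filter.atTop (nhds 0) := by
      rw [← mul_zero α⁻¹]
      exact (tendsto_rpow_neg_atTop hα0).const_mul _
    refine squeeze_zero_norm' ?_ h0
    filter_upwards [Filter.eventually_gt_atTop 0] with s hs
    rw [Pi.mul_apply, hn s hs]
    exact mul_le_of_le_one_left (by positivity) (by linarith [Real.exp_pos (-(c * s))])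

theorem integrable_exp_mul_cos {b : ℝ} (hb : 0 < b) (c : ℝ) :
    Integrable fun x : ℝ => Real.exp (-(b * x ^ 2)) * Real.cos (c * x) := by
  have h := integrable_exp_neg_mul_sq hb
  simp only [neg_mul] at h
  exact h.mono' (Continuous.aestronglyMeasurable (by fun_prop))
    (Filter.Eventually.of_forall fun x =>
      abs_le.2 (abs_le.1 (by
        rw [abs_mul, abs_of_pos (Real.exp_pos _)]
        exact mul_le_of_le_one_right (Real.exp_pos _).le (Real.abs_cos_le_one _))))

theorem integral_exp_mul_cos {b : ℝ} (hb : 0 < b) (c : ℝ) :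
    ∫ x : ℝ, Real.exp (-(b * x ^ 2)) * Real.cos (c * x) =
      Real.sqrt (Real.pi / b) * Real.exp (-(c ^ 2 / (4 * b))) := by
  have h := fourierIntegral_gaussian (b := (b : ℂ)) (by simpa using hb) (c : ℂ)
  have hr := congrArg Complex.re h
  rw [← RCLike.re_to_complex, ← integral_re] at hr
  · convert! hr using 1
    · congr 1
      funext x
      rw [show (-(b : ℂ) * (x : ℂ) ^ 2) = ((-(b * x ^ 2) : ℝ) : ℂ) by push_cast; ring,
        show Complex.I * (c : ℂ) * (x : ℂ) = ((c * x : ℝ) : ℂ) * Complex.I by push_cast; ring,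
        ← Complex.ofReal_exp, RCLike.re_to_complex, mul_comm (Complex.exp _),
        Complex.re_ofReal_mul, Complex.exp_ofReal_mul_I_re]
    · rw [show (-(c : ℂ) ^ 2 / (4 * b)) = ((-(c ^ 2 / (4 * b)) : ℝ) : ℂ) by push_cast; ring,
        ← Complex.ofReal_exp, ← Complex.ofReal_div,
        show (1 / 2 : ℂ) = ((1 / 2 : ℝ) : ℂ) by push_cast; rfl,
        ← Complex.ofReal_cpow (by positivity), ← Complex.ofReal_mul, Complex.ofReal_re,
        Real.sqrt_eq_rpow]
  · have h0 := integrable_cexp_quadratic (b := (b : ℂ)) (by simpa using hb) (Complex.I * c) 0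
    refine h0.congr (Filter.Eventually.of_forall fun x => ?_)
    simp only
    rw [← Complex.exp_add]
    congr 1
    ring

theorem integral_Ioi_gaussian_one_sub_cos {s : ℝ} (hs : 0 < s) :
    ∫ x in Set.Ioi (0 : ℝ), Real.exp (-(x ^ 2 / s)) * (1 - Real.cos (2 * Real.pi * x)) =
      Real.sqrt Real.pi / 2 * Real.sqrt s * (1 - Real.exp (-(Real.pi ^ 2 * s))) := by
  -- The constant 1 is treated as the cosine of frequency 0; evenness then gives half of the
  -- integral over the line.
  have h1 := integral_exp_mul_cos (b := s⁻¹) (by positivity) 0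
  have h2 := integral_exp_mul_cos (b := s⁻¹) (by positivity) (2 * Real.pi)
  have i1 := integrable_exp_mul_cos (b := s⁻¹) (by positivity) 0
  have i2 := integrable_exp_mul_cos (b := s⁻¹) (by positivity) (2 * Real.pi)
  have h3 := integral_sub i1 i2
  rw [h1, h2] at h3
  have h4 := integral_comp_abs (f := fun x : ℝ =>
    Real.exp (-(x ^ 2 / s)) * (1 - Real.cos (2 * Real.pi * x)))
  have h5 : ∀ x : ℝ, Real.exp (-(|x| ^ 2 / s)) * (1 - Real.cos (2 * Real.pi * |x|)) =
      Real.exp (-(s⁻¹ * x ^ 2)) * Real.cos (0 * x) -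
        Real.exp (-(s⁻¹ * x ^ 2)) * Real.cos (2 * Real.pi * x) := fun x => by
    have : Real.cos (2 * Real.pi * |x|) = Real.cos (2 * Real.pi * x) := by
      rcases abs_choice x with h | h <;> rw [h]
      rw [mul_neg, Real.cos_neg]
    rw [this, sq_abs, zero_mul, Real.cos_zero, div_eq_inv_mul]
    ring
  simp only [h5] at h4
  rw [h4] at h3
  have h6 : Real.sqrt (Real.pi / s⁻¹) = Real.sqrt Real.pi * Real.sqrt s := by
    rw [div_inv_eq_mul, Real.sqrt_mul Real.pi_pos.le]
  have h7 : (2 * Real.pi) ^ 2 / (4 * s⁻¹) = Real.pi ^ 2 * s := by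
    field_simp
    ring
  rw [h6, h7] at h3
  simp only [ne_eq, OfNat.ofNat_ne_zero, not_false_eq_true, zero_pow, zero_div, neg_zero,
    Real.exp_zero, mul_one] at h3
  linarith

/-- The substitution s ↦ 1/s turns this into a Gamma integral. -/
theorem integral_rpow_mul_exp_neg_div {a r : ℝ} (ha : 0 < a) (hr : 0 < r) :
    ∫ s in Set.Ioi (0 : ℝ), s ^ (-a - 1) * Real.exp (-(r / s)) = (1 / r) ^ a * Real.Gamma a := by
  rw [← Real.integral_rpow_mul_exp_neg_mul_Ioi ha hr,
    ← integral_comp_rpow_Ioi (fun t : ℝ => t ^ (a - 1) * Real.exp (-(r * t)))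
      (p := -1) (by norm_num)]
  refine setIntegral_congr_fun measurableSet_Ioi fun s hs => ?_
  have hs : 0 < s := hs
  simp only [abs_neg, abs_one, one_mul, smul_eq_mul]
  rw [← mul_assoc, ← Real.rpow_mul hs.le, ← Real.rpow_add hs, Real.rpow_neg_one, div_eq_mul_inv]
  ring_nf

theorem sqrt_mul_rpow {α s : ℝ} (hs : 0 < s) :
    Real.sqrt s * s ^ (-(α + 1 / 2) - 1) = s ^ (-1 - α) := by
  rw [Real.sqrt_eq_rpow, ← Real.rpow_add hs]
  ring_nf

/-- The radial part of `betaCoeff`. -/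
theorem integral_rpow_mul_one_sub_cos {α : ℝ} (hα0 : 0 < α) (hα1 : α < 1) :
    ∫ ρ in Set.Ioi (0 : ℝ), ρ ^ (-1 - 2 * α) * (1 - Real.cos (2 * Real.pi * ρ)) =
      Real.sqrt Real.pi * Real.pi ^ (2 * α) * Real.Gamma (1 - α) /
        (2 * α * Real.Gamma (α + 1 / 2)) := by
  have hG : 0 < Real.Gamma (α + 1 / 2) := Real.Gamma_pos_of_pos (by linarith)
  -- Integrated in s, this kernel gives Γ(α+1/2)ρ^{-1-2α}(1 - cos 2πρ); integrated in ρ, it gives a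
  -- Gaussian cosine integral. Comparing the two orders evaluates the radial integral.
  set K : ℝ → ℝ → ℝ := fun ρ s => s ^ (-(α + 1 / 2) - 1) *
    (Real.exp (-(ρ ^ 2 / s)) * (1 - Real.cos (2 * Real.pi * ρ))) with hK
  have hK0 : ∀ ρ s : ℝ, 0 < s → 0 ≤ K ρ s := fun ρ s hs => by
    have := sub_nonneg.2 (Real.cos_le_one (2 * Real.pi * ρ))
    simp only [hK]
    positivity
  have hρ : ∀ s : ℝ, 0 < s → ∫ ρ in Set.Ioi (0 : ℝ), K ρ s =
      Real.sqrt Real.pi / 2 * ((1 - Real.exp (-(Real.pi ^ 2 * s))) * s ^ (-1 - α)) :=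
    fun s hs => by
      simp only [hK]
      rw [integral_const_mul, integral_Ioi_gaussian_one_sub_cos hs, ← sqrt_mul_rpow hs]
      ring
  have hi : Integrable (Function.uncurry K)
      ((volume.restrict (Set.Ioi 0)).prod (volume.restrict (Set.Ioi 0))) := by
    have hm : AEStronglyMeasurable (Function.uncurry K)
        ((volume.restrict (Set.Ioi 0)).prod (volume.restrict (Set.Ioi 0))) := by
      apply Measurable.aestronglyMeasurable
      simp only [hK]
      unfold Function.uncurry
      fun_prop
    rw [integrable_prod_iff' hm]
    constructor
    · filter_upwards [ae_restrict_mem measurableSet_Ioi] with s hs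
      have hs : 0 < s := hs
      have i1 := integrable_exp_mul_cos (b := s⁻¹) (by positivity) 0
      have i2 := integrable_exp_mul_cos (b := s⁻¹) (by positivity) (2 * Real.pi)
      refine (((i1.sub i2).const_mul (s ^ (-(α + 1 / 2) - 1))).congr
        (Filter.Eventually.of_forall fun ρ => ?_)).integrableOn
      simp only [Pi.sub_apply, Function.uncurry_apply_pair, hK, zero_mul, Real.cos_zero,
        div_eq_inv_mul]
      ring
    · have h := (integrableOn_rpow_mul_one_sub_exp hα0 hα1
        (pow_pos Real.pi_pos 2)).const_mul (Real.sqrt Real.pi / 2)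
      refine h.congr ?_
      filter_upwards [ae_restrict_mem measurableSet_Ioi] with s hs
      rw [← hρ s hs]
      refine integral_congr_ae (Filter.Eventually.of_forall fun ρ => ?_)
      simp only [Function.uncurry_apply_pair]
      rw [Real.norm_eq_abs, abs_of_nonneg (hK0 ρ s hs)]
  have h1 : ∫ ρ in Set.Ioi (0 : ℝ), ∫ s in Set.Ioi (0 : ℝ), K ρ s =
      Real.Gamma (α + 1 / 2) *
        ∫ ρ in Set.Ioi (0 : ℝ), ρ ^ (-1 - 2 * α) * (1 - Real.cos (2 * Real.pi * ρ)) := by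
    rw [← integral_const_mul]
    refine setIntegral_congr_fun measurableSet_Ioi fun ρ h0 => ?_
    have h0 : 0 < ρ := h0
    simp only [hK, ← mul_assoc]
    rw [integral_mul_const, integral_rpow_mul_exp_neg_div (by linarith) (pow_pos h0 2),
      mul_comm (Real.Gamma _)]
    congr 2
    rw [one_div, Real.inv_rpow (by positivity), ← Real.rpow_natCast ρ 2, ← Real.rpow_mul h0.le,
      ← Real.rpow_neg h0.le]
    congr 1
    push_cast
    ring
  have h2 : ∫ s in Set.Ioi (0 : ℝ), ∫ ρ in Set.Ioi (0 : ℝ), K ρ s =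
      Real.sqrt Real.pi / 2 * (Real.pi ^ (2 * α) * Real.Gamma (1 - α) / α) := by
    rw [setIntegral_congr_fun measurableSet_Ioi hρ, integral_const_mul,
      integral_rpow_mul_one_sub_exp hα0 hα1 (pow_pos Real.pi_pos 2), ← Real.rpow_natCast,
      ← Real.rpow_mul Real.pi_pos.le]
    norm_cast
  rw [integral_integral_swap hi, h2] at h1
  field_simp at h1 ⊢
  linarith

theorem integral_Ioo_beta {a b : ℝ} (ha : 0 < a) (hb : 0 < b) :
    ∫ x in Set.Ioo (0 : ℝ) 1, x ^ (a - 1) * (1 - x) ^ (b - 1) =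
      Real.Gamma a * Real.Gamma b / Real.Gamma (a + b) := by
  have h := ProbabilityTheory.beta_eq_betaIntegralReal a b ha hb
  rw [ProbabilityTheory.beta] at h
  have hc := Complex.betaIntegral_convergent (u := a) (v := b) (by simpa) (by simpa)
  rw [h, Complex.betaIntegral, intervalIntegral.integral_of_le zero_le_one,
    ← integral_Ioc_eq_integral_Ioo, ← RCLike.re_to_complex, ← integral_re
      ((intervalIntegrable_iff_integrableOn_Ioc_of_le zero_le_one).1 hc)]
  refine setIntegral_congr_fun measurableSet_Ioc fun x hx => ?_
  have h1 : (0 : ℝ) ≤ 1 - x := sub_nonneg.2 hx.2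
  simp only [RCLike.re_to_complex]
  rw [show (a : ℂ) - 1 = ((a - 1 : ℝ) : ℂ) by push_cast; rfl,
    show (b : ℂ) - 1 = ((b - 1 : ℝ) : ℂ) by push_cast; rfl,
    show (1 : ℂ) - x = ((1 - x : ℝ) : ℂ) by push_cast; rfl,
    ← Complex.ofReal_cpow hx.1.le, ← Complex.ofReal_cpow h1, ← Complex.ofReal_mul,
    Complex.ofReal_re]

/-- The angular part of `betaL`. -/
theorem integral_angular {α : ℝ} (hα : 0 < α) :
    ∫ u in Set.Ioo (0 : ℝ) 1, (1 - u ^ 2) * u ^ (2 * α) * (1 - u ^ 2) ^ (-(1 / 2) : ℝ) =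
      Real.Gamma (α + 1 / 2) * (Real.sqrt Real.pi / 2) / (2 * Real.Gamma (2 + α)) := by
  have hb := integral_Ioo_beta (a := α + 1 / 2) (b := 3 / 2) (by linarith) (by norm_num)
  have h32 : Real.Gamma (3 / 2) = Real.sqrt Real.pi / 2 := by
    rw [show (3 / 2 : ℝ) = 1 / 2 + 1 by norm_num, Real.Gamma_add_one (by norm_num),
      Real.Gamma_one_half_eq]
    ring
  rw [h32, show α + 1 / 2 + 3 / 2 = 2 + α by ring, show α + 1 / 2 - 1 = α - 1 / 2 by ring,
    show (3 / 2 - 1 : ℝ) = 1 / 2 by norm_num] at hb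
  -- Substitution x = u² in the Beta integral with parameters α + 1/2 and 3/2; the indicator extends
  -- it to the half-line.
  have h := integral_comp_rpow_Ioi_of_pos (p := 2) (g := (Set.Ioo (0 : ℝ) 1).indicator
    fun x : ℝ => x ^ (α - 1 / 2) * (1 - x) ^ (1 / 2 : ℝ)) two_pos
  have hs : Set.Ioi (0 : ℝ) ∩ Set.Ioo 0 1 = Set.Ioo 0 1 :=
    Set.inter_eq_right.2 fun x hx => hx.1
  rw [setIntegral_indicator measurableSet_Ioo, hs, hb] at h
  have h2 : ∫ u in Set.Ioi (0 : ℝ), (2 * u ^ (2 - 1 : ℝ)) • (Set.Ioo (0 : ℝ) 1).indicator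
      (fun x : ℝ => x ^ (α - 1 / 2) * (1 - x) ^ (1 / 2 : ℝ)) (u ^ (2 : ℝ)) =
      2 * ∫ u in Set.Ioo (0 : ℝ) 1,
        (1 - u ^ 2) * u ^ (2 * α) * (1 - u ^ 2) ^ (-(1 / 2) : ℝ) := by
    rw [← integral_const_mul]
    conv_rhs => rw [← hs, ← setIntegral_indicator measurableSet_Ioo]
    refine setIntegral_congr_fun measurableSet_Ioi fun u hu => ?_
    have hu : 0 < u := hu
    by_cases h1 : u < 1
    · have hu2 : u ^ (2 : ℝ) = u ^ 2 := by norm_cast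
      have hlt : u ^ 2 < 1 := by nlinarith
      have hpos : 0 < 1 - u ^ 2 := by linarith
      have hm : u ^ (2 : ℝ) ∈ Set.Ioo (0 : ℝ) 1 := by rw [hu2]; exact ⟨by positivity, hlt⟩
      have hm' : u ∈ Set.Ioo (0 : ℝ) 1 := ⟨hu, h1⟩
      simp only [Set.indicator_of_mem hm, Set.indicator_of_mem hm', smul_eq_mul]
      rw [hu2]
      have e1 : (1 - u ^ 2) ^ (1 / 2 : ℝ) = (1 - u ^ 2) * (1 - u ^ 2) ^ (-(1 / 2) : ℝ) := by
        rw [← Real.rpow_one_add' hpos.le (by norm_num)]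
        norm_num
      have e2 : u ^ (2 * α) = u ^ (2 - 1 : ℝ) * (u ^ 2) ^ (α - 1 / 2) := by
        rw [← Real.rpow_natCast u 2, ← Real.rpow_mul hu.le, ← Real.rpow_add hu]
        congr 1
        push_cast
        ring
      rw [e1, e2]
      ring
    · have h1 : 1 ≤ u := not_lt.1 h1
      have hm : u ^ (2 : ℝ) ∉ Set.Ioo (0 : ℝ) 1 := fun h =>
        absurd h.2 (not_lt.2 (Real.one_le_rpow h1 (by norm_num)))
      have hm' : u ∉ Set.Ioo (0 : ℝ) 1 := fun h => absurd h.2 (not_lt.2 h1)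
      simp only [Set.indicator_of_notMem hm, Set.indicator_of_notMem hm', smul_zero]
  rw [h2] at h
  field_simp at h ⊢
  linarith

theorem coercivityConst_eq {α : ℝ} (hα0 : 0 < α) (hα1 : α < 1) :
    coercivityConst α = Real.pi / (8 * (α * (α + 1))) := by
  have h1 : 0 < Real.Gamma (α + 1 / 2) := Real.Gamma_pos_of_pos (by linarith)
  have h2 : 0 < Real.Gamma (1 - α) := Real.Gamma_pos_of_pos (by linarith)
  have h3 : 0 < Real.Gamma α := Real.Gamma_pos_of_pos hα0
  have h4 : 0 < (2 : ℝ) ^ (2 * α) := by positivity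
  have h5 : 0 < Real.pi ^ (2 * α) := by positivity
  have h6 : Real.Gamma (2 + α) = (α + 1) * (α * Real.Gamma α) := by
    rw [Gamma_two_add hα0, add_comm 1 α, Real.Gamma_add_one hα0.ne']
  have h7 : Real.sqrt Real.pi * Real.sqrt Real.pi = Real.pi := Real.mul_self_sqrt Real.pi_pos.le
  rw [coercivityConst, betaL, betaCoeff, rieszGamma, integral_rpow_mul_one_sub_cos hα0 hα1,
    integral_angular hα0, h6, mul_div_cancel_left₀ _ two_ne_zero,
    Real.mul_rpow two_pos.le Real.pi_pos.le]
  field_simp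
  rw [sq, h7]
  ring

/-! ### Multiplication by a cutoff and the asymptotics at high frequency -/

theorem fourier_im_eq_zero_of_even {f : Plane → ℝ} (hf : ∀ x, f (-x) = f x) (n : Plane) :
    (𝓕 (fun x : Plane => (f x : ℂ)) n).im = 0 := by
  rw [← Complex.conj_eq_iff_im, Real.fourier_eq', ← integral_conj, ← integral_neg_eq_self]
  congr 1
  funext x
  simp [hf, ← Complex.exp_conj, Complex.conj_ofNat]

/-- The Fourier transform turns the product with a Schwartz function into a convolution. -/
theorem fourier_mul_schwartz {f : Plane → ℂ} (hf : Integrable f) (ψ : 𝓢(Plane, ℂ)) (n : Plane) :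
    𝓕 (fun x => f x * ψ x) n = ∫ m, (𝓕 ψ : 𝓢(Plane, ℂ)) m * 𝓕 f (n - m) := by
  set e : Plane → ℂ := fun x => Complex.exp (((-2 * Real.pi * inner ℝ x n : ℝ) : ℂ) * Complex.I)
    with he
  have hec : Continuous e := by fun_prop
  have hg : Integrable fun x => e x * f x :=
    hf.norm.mono' (hec.aestronglyMeasurable.mul hf.aestronglyMeasurable)
      (Filter.Eventually.of_forall fun x => by
        rw [norm_mul, Complex.norm_exp_ofReal_mul_I, one_mul])
  -- Self-adjointness of the transform. The form `-innerₗ` makes both transforms inverse ones, so 𝓕ψ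
  -- returns to ψ, while the modulation by e turns the other into 𝓕f at n - m.
  have h := VectorFourier.integral_fourierIntegral_smul_eq_flip (μ := volume) (ν := volume)
    (L := -innerₗ Plane) Real.continuous_fourierChar
    (continuous_inner.neg) (𝓕 ψ : 𝓢(Plane, ℂ)).integrable hg
  have hflip : (-innerₗ Plane : Plane →ₗ[ℝ] Plane →ₗ[ℝ] ℝ).flip = -innerₗ Plane := by
    ext x y; simp [real_inner_comm]
  rw [hflip] at h
  have h1 : 𝓕⁻ (𝓕 ψ : 𝓢(Plane, ℂ)) = ψ := FourierTransform.fourierInv_fourier_eq ψ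
  have h2 : ∀ x, VectorFourier.fourierIntegral Real.fourierChar volume (-innerₗ Plane)
      (𝓕 ψ : 𝓢(Plane, ℂ)) x = ψ x := fun x => by
    conv_rhs => rw [← h1, SchwartzMap.fourierInv_coe]
    rfl
  have h3 : ∀ m, VectorFourier.fourierIntegral Real.fourierChar volume (-innerₗ Plane)
      (fun x => e x * f x) m = 𝓕 f (n - m) := fun m => by
    change 𝓕⁻ (fun x => e x * f x) m = _
    rw [Real.fourierInv_eq', Real.fourier_eq']
    congr 1
    funext x
    simp only [smul_eq_mul, he]
    rw [← mul_assoc, ← Complex.exp_add, inner_sub_right]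
    congr 2
    push_cast
    ring
  simp only [h2, h3, smul_eq_mul] at h
  rw [← h, Real.fourier_eq']
  congr 1
  funext x
  simp only [smul_eq_mul, he]
  ring

theorem integral_fourier_schwartz (ψ : 𝓢(Plane, ℂ)) : ∫ m, (𝓕 ψ : 𝓢(Plane, ℂ)) m = ψ 0 := by
  have h1 : 𝓕⁻ (𝓕 ψ : 𝓢(Plane, ℂ)) = ψ := FourierTransform.fourierInv_fourier_eq ψ
  conv_rhs => rw [← h1, SchwartzMap.fourierInv_coe, Real.fourierInv_eq']
  simp

theorem tendsto_norm_sub_sq_div (m : Plane) :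
    Filter.Tendsto (fun n : Plane => ‖n - m‖ ^ 2 / (1 + ‖n‖ ^ 2))
      (Filter.comap (fun n : Plane => ‖n‖) Filter.atTop) (nhds 1) := by
  have h0 : Filter.Tendsto (fun n : Plane => (‖m‖ ^ 2 + 1 + 2 * ‖m‖) * ‖n‖⁻¹)
      (Filter.comap (fun n : Plane => ‖n‖) Filter.atTop) (nhds 0) := by
    have h := (tendsto_inv_atTop_zero.comp (Filter.tendsto_comap (f := fun n : Plane => ‖n‖)
      (x := Filter.atTop))).const_mul (‖m‖ ^ 2 + 1 + 2 * ‖m‖)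
    rwa [mul_zero] at h
  rw [← tendsto_sub_nhds_zero_iff]
  refine squeeze_zero_norm' ?_ h0
  filter_upwards [Filter.tendsto_comap.eventually (Filter.eventually_ge_atTop 1)] with n hn
  have hi := abs_le.1 (abs_real_inner_le_norm n m)
  have hp : 0 < 1 + ‖n‖ ^ 2 := by positivity
  have hn0 : 0 < ‖n‖ := by linarith
  rw [norm_sub_sq_real, div_sub_one hp.ne', Real.norm_eq_abs, abs_div, abs_of_pos hp,
    ← div_eq_mul_inv, div_le_div_iff₀ hp hn0]
  have h1 : |‖n‖ ^ 2 - 2 * inner ℝ n m + ‖m‖ ^ 2 - (1 + ‖n‖ ^ 2)| ≤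
      ‖m‖ ^ 2 + 1 + 2 * ‖m‖ * ‖n‖ := by
    rw [abs_le]
    constructor <;> nlinarith [sq_nonneg ‖m‖]
  have h2 : ‖m‖ ^ 2 + 1 + 2 * ‖m‖ * ‖n‖ ≤ (‖m‖ ^ 2 + 1 + 2 * ‖m‖) * ‖n‖ := by
    nlinarith [sq_nonneg ‖m‖]
  calc _ ≤ (‖m‖ ^ 2 + 1 + 2 * ‖m‖) * ‖n‖ * ‖n‖ := by gcongr; exact h1.trans h2
    _ ≤ _ := by
      have : 0 ≤ ‖m‖ ^ 2 + 1 + 2 * ‖m‖ := by positivity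
      nlinarith

/-- The two bounds of the symbol become powers of (|n-m|²+1)/(1+|n|²) and |n-m|²/(1+|n|²), both
bases tending to 1. -/
theorem tendsto_mixtureSymbol {α : ℝ} (hα : 0 < α) (m : Plane) :
    Filter.Tendsto (fun n : Plane => (1 + ‖n‖ ^ 2) ^ α * mixtureSymbol α (‖n - m‖ ^ 2))
      (Filter.comap (fun n : Plane => ‖n‖) Filter.atTop) (nhds (1 / (α * (α + 1)))) := by
  have hu := tendsto_norm_sub_sq_div m
  have hi : Filter.Tendsto (fun n : Plane => (1 + ‖n‖ ^ 2)⁻¹)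
      (Filter.comap (fun n : Plane => ‖n‖) Filter.atTop) (nhds 0) := by
    refine tendsto_inv_atTop_zero.comp (Filter.tendsto_atTop_add_const_left _ _ ?_)
    exact (Filter.tendsto_pow_atTop two_ne_zero).comp Filter.tendsto_comap
  have hv := hu.add hi
  rw [add_zero] at hv
  have hpow : ∀ {u : Plane → ℝ}, Filter.Tendsto u
      (Filter.comap (fun n : Plane => ‖n‖) Filter.atTop) (nhds 1) →
      Filter.Tendsto (fun n => 1 / (α * (α + 1)) * u n ^ (-α))
      (Filter.comap (fun n : Plane => ‖n‖) Filter.atTop) (nhds (1 / (α * (α + 1)))) := fun h => by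
    have := (h.rpow_const (p := -α) (Or.inl one_ne_zero)).const_mul (1 / (α * (α + 1)))
    rwa [Real.one_rpow, mul_one] at this
  have key : ∀ {a b : ℝ}, 0 < a → 0 ≤ b → (b / a) ^ (-α) = a ^ α * b ^ (-α) := fun ha hb => by
    rw [Real.div_rpow hb ha.le, Real.rpow_neg ha.le, div_inv_eq_mul, mul_comm]
  refine tendsto_of_tendsto_of_tendsto_of_le_of_le' (hpow hv) (hpow hu) ?_ ?_
  · refine Filter.Eventually.of_forall fun n => ?_
    have hp : 0 < 1 + ‖n‖ ^ 2 := by positivity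
    rw [← one_div, ← add_div, key hp (by positivity), mul_left_comm, add_comm (‖n - m‖ ^ 2)]
    gcongr
    exact le_mixtureSymbol hα (by positivity)
  · filter_upwards [hu.eventually (lt_mem_nhds zero_lt_one)] with n hn
    have hp : 0 < 1 + ‖n‖ ^ 2 := by positivity
    have hpos : 0 < ‖n - m‖ ^ 2 := (div_pos_iff_of_pos_right hp).1 hn
    rw [key hp hpos.le, mul_left_comm]
    gcongr
    exact mixtureSymbol_le hα hpos

/-- Peetre's inequality: it trades the weight at n for the weight at n - m and polynomial growth in
m. -/
theorem one_add_norm_sq_le (n m : Plane) :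
    1 + ‖n‖ ^ 2 ≤ 2 * (1 + ‖m‖ ^ 2) * (1 + ‖n - m‖ ^ 2) := by
  have h : ‖n‖ ≤ ‖n - m‖ + ‖m‖ := by simpa using norm_add_le (n - m) m
  nlinarith [sq_nonneg (‖n - m‖ - ‖m‖), norm_nonneg n, norm_nonneg m, norm_nonneg (n - m),
    mul_nonneg (sq_nonneg ‖m‖) (sq_nonneg ‖n - m‖)]

/-- Dominated convergence in the convolution integral. Peetre's inequality and the uniform bound K
control the integrand by a multiple of (1+|m|²)|𝓕ψ(m)|, and the total mass of 𝓕ψ is ψ(0). -/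
theorem tendsto_fourier_mixture_mul {α : ℝ} (hα0 : 0 < α) (hα1 : α < 1) (ψ : 𝓢(Plane, ℂ)) :
    Filter.Tendsto (fun n : Plane => (((1 + ‖n‖ ^ 2) ^ α : ℝ) : ℂ) *
        𝓕 (fun x => (gaussianMixture α x : ℂ) * ψ x) n)
      (Filter.comap (fun n : Plane => ‖n‖) Filter.atTop)
      (nhds (((Real.pi⁻¹ * (1 / (α * (α + 1))) : ℝ) : ℂ) * ψ 0)) := by
  obtain ⟨K, hK0, hK⟩ := exists_mixtureSymbol_le hα0
  have hI : Integrable fun x : Plane => (gaussianMixture α x : ℂ) :=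
    (integrable_gaussianMixture hα0).ofReal
  -- Continuity is inherited from the Fourier transform of an integrable function.
  have hF : Continuous fun n : Plane => mixtureSymbol α (‖n‖ ^ 2) := by
    have h1 : Continuous (𝓕 fun x : Plane => (gaussianMixture α x : ℂ)) :=
      VectorFourier.fourierIntegral_continuous Real.continuous_fourierChar
        continuous_inner hI
    have h2 := (Complex.continuous_re.comp h1).const_mul Real.pi
    refine h2.congr fun n => ?_
    simp only [Function.comp_apply]
    rw [fourier_gaussianMixture hα0, Complex.ofReal_re, mul_inv_cancel_left₀ Real.pi_ne_zero]
  have hform : ∀ n : Plane, (((1 + ‖n‖ ^ 2) ^ α : ℝ) : ℂ) *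
        𝓕 (fun x => (gaussianMixture α x : ℂ) * ψ x) n =
      ∫ m, (𝓕 ψ : 𝓢(Plane, ℂ)) m *
        ((Real.pi⁻¹ * ((1 + ‖n‖ ^ 2) ^ α * mixtureSymbol α (‖n - m‖ ^ 2)) : ℝ) : ℂ) := fun n => by
    rw [fourier_mul_schwartz hI, ← integral_const_mul]
    congr 1
    funext m
    rw [fourier_gaussianMixture hα0]
    push_cast
    ring
  simp only [hform]
  have hlim : ((Real.pi⁻¹ * (1 / (α * (α + 1))) : ℝ) : ℂ) * ψ 0 =
      ∫ m, (𝓕 ψ : 𝓢(Plane, ℂ)) m * ((Real.pi⁻¹ * (1 / (α * (α + 1))) : ℝ) : ℂ) := by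
    rw [integral_mul_const, integral_fourier_schwartz, mul_comm]
  rw [hlim]
  have hb : Integrable fun m : Plane => Real.pi⁻¹ * (2 ^ α * K) *
      (‖m‖ ^ 0 * ‖(𝓕 ψ : 𝓢(Plane, ℂ)) m‖ + ‖m‖ ^ 2 * ‖(𝓕 ψ : 𝓢(Plane, ℂ)) m‖) :=
    (((𝓕 ψ : 𝓢(Plane, ℂ)).integrable_pow_mul volume 0).add
      ((𝓕 ψ : 𝓢(Plane, ℂ)).integrable_pow_mul volume 2)).const_mul _
  refine tendsto_integral_filter_of_dominated_convergence _ (Filter.Eventually.of_forall fun n => ?_)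
    (Filter.Eventually.of_forall fun n => Filter.Eventually.of_forall fun m => ?_) hb
    (Filter.Eventually.of_forall fun m => ?_)
  · have h1 : Continuous fun m : Plane => mixtureSymbol α (‖n - m‖ ^ 2) :=
      hF.comp (continuous_const.sub continuous_id)
    exact ((𝓕 ψ : 𝓢(Plane, ℂ)).continuous.mul (Complex.continuous_ofReal.comp
      (continuous_const.mul (continuous_const.mul h1)))).aestronglyMeasurable
  · have h0 := mixtureSymbol_nonneg hα0 (‖n - m‖ ^ 2)
    have h1 : (1 + ‖n‖ ^ 2) ^ α * mixtureSymbol α (‖n - m‖ ^ 2) ≤ 2 ^ α * K * (1 + ‖m‖ ^ 2) := by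
      calc (1 + ‖n‖ ^ 2) ^ α * mixtureSymbol α (‖n - m‖ ^ 2)
          ≤ (2 * (1 + ‖m‖ ^ 2) * (1 + ‖n - m‖ ^ 2)) ^ α * mixtureSymbol α (‖n - m‖ ^ 2) := by
            gcongr
            exact one_add_norm_sq_le n m
        _ = 2 ^ α * ((1 + ‖n - m‖ ^ 2) ^ α * mixtureSymbol α (‖n - m‖ ^ 2)) *
            (1 + ‖m‖ ^ 2) ^ α := by
            rw [Real.mul_rpow (by positivity) (by positivity),
              Real.mul_rpow (by positivity) (by positivity)]
            ring
        _ ≤ 2 ^ α * K * (1 + ‖m‖ ^ 2) := by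
            gcongr
            · exact hK _ (by positivity)
            · exact Real.rpow_le_self_of_one_le (by nlinarith [sq_nonneg ‖m‖]) hα1.le
    rw [norm_mul, Complex.norm_real, Real.norm_eq_abs, abs_of_nonneg (by positivity)]
    calc _ ≤ ‖(𝓕 ψ : 𝓢(Plane, ℂ)) m‖ * (Real.pi⁻¹ * (2 ^ α * K * (1 + ‖m‖ ^ 2))) := by gcongr
      _ = _ := by ring
  · exact ((Complex.continuous_ofReal.tendsto _).comp
      ((tendsto_mixtureSymbol hα0 m).const_mul _)).const_mul _

/-! ### The kernel A and its Fourier transform -/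

theorem gaussianMixture_neg (α : ℝ) (x : Plane) :
    gaussianMixture α (-x) = gaussianMixture α x := by
  simp [gaussianMixture]

theorem A_ae_eq {α : ℝ} (hα : 0 < α) (φ : Plane → ℝ) :
    A α φ =ᵐ[volume] fun x => -(Real.pi ^ 2 / 2) * (gaussianMixture α x * φ x) := by
  have hne : ∀ᵐ x : Plane, x ≠ 0 := by
    simp [ae_iff]
  filter_upwards [hne] with x hx
  rw [A, trace_Q_mul_hessian hα hx]
  ring

theorem IsRadialCutoff.hasCompactSupport {φ : Plane → ℝ} (hφ : IsRadialCutoff φ) :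
    HasCompactSupport φ := by
  refine HasCompactSupport.intro (isCompact_closedBall (0 : Plane) 2) fun x hx => ?_
  rw [mem_closedBall_zero_iff, not_le] at hx
  exact hφ.eq_zero x hx.le

theorem integrable_A {α : ℝ} (hα : 0 < α) {φ : Plane → ℝ} (hφ : IsRadialCutoff φ) :
    Integrable (A α φ) := by
  refine (Integrable.const_mul ?_ _).congr (A_ae_eq hα φ).symm
  refine (integrable_gaussianMixture hα).norm.mono'
    ((integrable_gaussianMixture hα).aestronglyMeasurable.mul
      hφ.smooth.continuous.aestronglyMeasurable) (Filter.Eventually.of_forall fun x => ?_)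
  rw [norm_mul]
  refine mul_le_of_le_one_right (norm_nonneg _) ?_
  rw [Real.norm_eq_abs, abs_of_nonneg (hφ.nonneg x)]
  exact hφ.le_one x

theorem fourier_A_im {α : ℝ} (hα : 0 < α) {φ : Plane → ℝ} (hφ : IsRadialCutoff φ) (n : Plane) :
    (𝓕 (fun x : Plane => (A α φ x : ℂ)) n).im = 0 := by
  have h : 𝓕 (fun x : Plane => (A α φ x : ℂ)) n = 𝓕 (fun x : Plane =>
      ((-(Real.pi ^ 2 / 2) * (gaussianMixture α x * φ x) : ℝ) : ℂ)) n := by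
    rw [Real.fourier_eq', Real.fourier_eq']
    refine integral_congr_ae ?_
    filter_upwards [A_ae_eq hα φ] with x hx
    rw [hx]
  rw [h]
  exact fourier_im_eq_zero_of_even (fun x => by
    rw [gaussianMixture_neg, hφ.radial (-x) x (norm_neg x)]) n

/-- The leading asymptotics of the Fourier transform of `A`. -/
theorem tendsto_fourier_A {α : ℝ} (hα0 : 0 < α) (hα1 : α < 1) {φ : Plane → ℝ}
    (hφ : IsRadialCutoff φ) :
    Filter.Tendsto (fun n : Plane => (1 + ‖n‖ ^ 2) ^ α *
        (𝓕 (fun x : Plane => (A α φ x : ℂ)) n).re)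
      (Filter.comap (fun n : Plane => ‖n‖) Filter.atTop)
      (nhds (-(Real.pi / (2 * (α * (α + 1)))))) := by
  have hs : ContDiff ℝ ∞ fun x : Plane => (φ x : ℂ) :=
    Complex.ofRealCLM.contDiff.comp hφ.smooth
  have hcs : HasCompactSupport fun x : Plane => (φ x : ℂ) :=
    hφ.hasCompactSupport.comp_left Complex.ofReal_zero
  set ψ : 𝓢(Plane, ℂ) := hcs.toSchwartzMap hs with hψ
  have hψx : ∀ x, ψ x = (φ x : ℂ) := fun x => rfl
  have h1 : ψ 0 = 1 := by
    rw [hψx, hφ.eq_one 0 (by simp), Complex.ofReal_one]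
  have h := (Complex.continuous_re.tendsto _).comp (tendsto_fourier_mixture_mul hα0 hα1 ψ)
  have h2 := h.const_mul (-(Real.pi ^ 2 / 2))
  rw [h1, mul_one, Complex.ofReal_re] at h2
  have h3 : -(Real.pi ^ 2 / 2) * (Real.pi⁻¹ * (1 / (α * (α + 1)))) =
      -(Real.pi / (2 * (α * (α + 1)))) := by
    field_simp
  rw [h3] at h2
  refine h2.congr fun n => ?_
  have h4 : 𝓕 (fun x : Plane => (A α φ x : ℂ)) n =
      ((-(Real.pi ^ 2 / 2) : ℝ) : ℂ) * 𝓕 (fun x => (gaussianMixture α x : ℂ) * ψ x) n := by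
    rw [Real.fourier_eq', Real.fourier_eq', ← integral_const_mul]
    refine integral_congr_ae ?_
    filter_upwards [A_ae_eq hα0 φ] with x hx
    rw [hx, hψx]
    push_cast
    simp only [smul_eq_mul]
    ring
  simp only [Function.comp_apply]
  rw [h4, Complex.re_ofReal_mul, Complex.re_ofReal_mul]
  ring

end Kraichnan

end

/-! ### The coercivity bound -/

theorem lemma4p3 (α : ℝ) (hα0 : 0 < α) (hα1 : α < 1)
    (φ : Kraichnan.Plane → ℝ) (hφ : Kraichnan.IsRadialCutoff φ) :
    0 < Kraichnan.coercivityConst α ∧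
    Integrable (Kraichnan.A α φ) volume ∧
    ∃ C : ℝ, 0 < C ∧ ∀ n : Kraichnan.Plane,
      (𝓕 (fun x : Kraichnan.Plane => (Kraichnan.A α φ x : ℂ)) n).im = 0 ∧
      (𝓕 (fun x : Kraichnan.Plane => (Kraichnan.A α φ x : ℂ)) n).re ≤
        -Kraichnan.coercivityConst α * Kraichnan.bracket n ^ (-2 * α) +
          C * Kraichnan.bracket n ^ (-2 : ℝ) := by
  have hpi := Real.pi_pos
  have hc : Kraichnan.coercivityConst α = Real.pi / (8 * (α * (α + 1))) :=
    Kraichnan.coercivityConst_eq hα0 hα1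
  have hc0 : 0 < Kraichnan.coercivityConst α := by rw [hc]; positivity
  refine ⟨hc0, Kraichnan.integrable_A hα0 hφ, ?_⟩
  set c := Kraichnan.coercivityConst α with hcdef
  set f : Kraichnan.Plane → ℂ := 𝓕 fun x : Kraichnan.Plane => (Kraichnan.A α φ x : ℂ) with hf
  -- The limit of ⟨n⟩^{2α}Â(n) equals -4c, hence lies strictly below -c.
  have hlt : -(Real.pi / (2 * (α * (α + 1)))) < -c := by
    have : Real.pi / (2 * (α * (α + 1))) = 4 * c := by
      rw [hc]
      field_simp
      norm_num
    rw [this]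
    linarith
  have hev := (Kraichnan.tendsto_fourier_A hα0 hα1 hφ).eventually (gt_mem_nhds hlt)
  obtain ⟨R, hR⟩ := Filter.eventually_atTop.1 (Filter.eventually_comap.1 hev)
  set M := ∫ x, ‖Kraichnan.A α φ x‖ with hM
  have hM0 : 0 ≤ M := integral_nonneg fun x => norm_nonneg _
  have hfM : ∀ n, (f n).re ≤ M := fun n => by
    refine (Complex.re_le_norm _).trans ?_
    rw [hf, Real.fourier_eq']
    refine (norm_integral_le_integral_norm _).trans (le_of_eq ?_)
    congr 1
    funext x
    rw [norm_smul, Complex.norm_exp_ofReal_mul_I, one_mul, Complex.norm_real]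
  have hC0 : 0 < (M + c) * (1 + R ^ 2) := by positivity
  -- For |n| ≤ R the chosen constant makes C⟨n⟩⁻² at least M + c: M, the L¹ norm of A, bounds the
  -- transform, and c compensates -c⟨n⟩^{-2α} ≥ -c. For |n| ≥ R only its positivity matters.
  refine ⟨(M + c) * (1 + R ^ 2), hC0, fun n => ⟨Kraichnan.fourier_A_im hα0 hφ n, ?_⟩⟩
  rw [Kraichnan.bracket_rpow, Kraichnan.bracket_rpow, show -2 * α / 2 = -α by ring,
    show (-2 : ℝ) / 2 = -1 by norm_num, Real.rpow_neg_one]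
  have hp : 0 < 1 + ‖n‖ ^ 2 := by positivity
  have hpα : 0 < (1 + ‖n‖ ^ 2) ^ α := by positivity
  rcases le_total R ‖n‖ with h | h
  · have h1 := hR ‖n‖ h n rfl
    have h2 : (f n).re ≤ -c * (1 + ‖n‖ ^ 2) ^ (-α) := by
      rw [Real.rpow_neg hp.le, ← div_eq_mul_inv, le_div_iff₀ hpα, mul_comm]
      exact h1.le
    have h3 : 0 ≤ (M + c) * (1 + R ^ 2) * (1 + ‖n‖ ^ 2)⁻¹ := by positivity
    linarith
  · have h1 : (1 + ‖n‖ ^ 2) ^ (-α) ≤ 1 :=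
      Real.rpow_le_one_of_one_le_of_nonpos (by nlinarith [sq_nonneg ‖n‖]) (by linarith)
    have h2 : M + c ≤ (M + c) * (1 + R ^ 2) * (1 + ‖n‖ ^ 2)⁻¹ := by
      rw [← div_eq_mul_inv, le_div_iff₀ hp]
      gcongr
    have h3 := hfM n
    nlinarith
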